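/- Equip $\mathbb R^3$ with $\langle a,b\rangle_E=a_1b_1+a_2b_2+a_3b_3$ (then called $\mathbb E^3$) or $\langle a,b\rangle_L=a_1b_1+a_2b_2-a_3b_3$ (then called $\mathbb L^3$), and with the vector products $a\times_E b=(a_2b_3-b_2a_3,\;a_3b_1-b_3a_1,\;a_1b_2-b_1a_2)$ and $a\times_L b=(a_2b_3-b_2a_3,\;a_3b_1-b_3a_1,\;-(a_1b_2-b_1a_2))$, respectively. All manifolds and maps are smooth. The Hodge star of an oriented Riemannian or Lorentzian surface $(M,g)$ is $*\alpha=\mathrm{vol}_g(\alpha^\sharp,\cdot)$ on 1-forms; thus for a positively oriented orthonormal coframe $*\omega^1=\omega^2$, $*\omega^2=-\omega^1$ if $g=(\omega^1)^2+(\omega^2)^2$, and $*\omega^1=\omega^2$, $*\omega^2=\omega^1$ if $g=(\omega^1)^2-(\omega^2)^2$. Consider an immersion $x$ of an oriented surface that is (i) an immersion into $\mathbb E^3$, (ii) a spacelike immersion into $\mathbb L^3$, or (iii) a timelike immersion into $\mathbb L^3$. Its Gauss map is $\mathbf n=e_1\times_E e_2$ in case (i) and $\mathbf n=-e_1\times_L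 e_2$ in cases (ii), (iii), where $(e_1,e_2)$ is a positively oriented orthonormal tangent frame (in case (iii) with $\langle e_1,e_1\rangle_L=1$, $\langle e_2,e_2\rangle_L=-1$). Its mean curvature with respect to a unit normal field $\mathbf n$ is half the trace, with respect to the induced metric, of the second fundamental form $h(v,w)=-\langle dx(v),d\mathbf n(w)\rangle$. The symbols $\langle\,,\rangle$ and $\times$ refer to $\mathbb E^3$ in case (i) and to $\mathbb L^3$ in cases (ii), (iii). (a) Let $M$ be a connected oriented surface and let $x$ be an immersion of $M$ as in (i), (ii) or (iii), with Gauss map $\mathbf n$ and nowhere vanishing mean curvature $H$ (with respect to $\mathbf n$). Then $$x=-\int\frac1{2H}\{d\mathbf n+\mathbf n\times(*d\mathbf n)\},$$ where $*$ is the Hodge star of the induced metric; that is, $dx=-\frac1{2H}\{d\mathbf n+\mathbf n\times(*d\mathbf n)\}$, and the increments of $x$ are the line integrals of this 1-form along $C^1$ curves in $M$. (b) Conversely, let $M$ be a simply connected oriented surface with a metric $g$ which is Riemannian in cases (i), (ii) and Lorentzian in case (iii), let $H\colon M\to\mathbb R$ be a nowhere vanishing function and let $\mathbf n\colon M\to\mathbb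 R^3$ satisfy $\langle\mathbf n,\mathbf n\rangle_E=1$ in case (i), $\langle\mathbf n,\mathbf n\rangle_L=-1$ in case (ii), $\langle\mathbf n,\mathbf n\rangle_L=1$ in case (iii). Put $\varphi=d\mathbf n+\mathbf n\times(*d\mathbf n)$, with $*$ the Hodge star of $g$, and suppose that $d(\varphi/H)=0$. Then there is a map $x\colon M\to\mathbb R^3$ with $x=-\int\frac1{2H}\varphi$. If moreover $\varphi$ is non-degenerate, in the sense that $\varphi_p\neq0$ for every $p\in M$ in cases (i), (ii), and that $\varphi_p\colon T_pM\to\mathbb R^3$ is injective for every $p\in M$ in case (iii), then every such $x$ is an immersion into $\mathbb E^3$ in case (i), a spacelike immersion into $\mathbb L^3$ in case (ii), a timelike immersion into $\mathbb L^3$ in case (iii); its Gauss map is $\mathbf n$ (in case (iii), for the given orientation of $M$ or for the opposite one), and its mean curvature with respect to $\mathbf n$ is $H$. -/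

import Mathlib

open scoped Manifold ContDiff Topology

noncomputable section

namespace Kenmotsu

/-- The model plane of a surface. -/
abbrev Plane : Type := EuclideanSpace ℝ (Fin 2)

/-- The vector space `ℝ³` underlying both `E³` and `L³`. -/
abbrev R3 : Type := Fin 3 → ℝ

/-- The three situations: surfaces in `E³`, spacelike surfaces in `L³`, timelike surfaces in `L³`. -/
inductive SurfaceType
  | euclidean
  | spacelike
  | timelike

namespace SurfaceType

/-- The sign of the third coordinate in the ambient scalar product and vector product. -/
def ambientSign : SurfaceType → ℝ
  | euclidean => 1
  | spacelike => -1
  | timelike => -1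

/-- The value of `⟨n, n⟩` for the unit normal vector: `n` lies in `S²`, `H²`, `S²₁`. -/
def normalSign : SurfaceType → ℝ
  | euclidean => 1
  | spacelike => -1
  | timelike => 1

/-- The value of `⟨e₂, e₂⟩` for an adapted orthonormal tangent frame `(e₁, e₂)`
(always `⟨e₁, e₁⟩ = 1`). -/
def frameSign : SurfaceType → ℝ
  | euclidean => 1
  | spacelike => 1
  | timelike => -1

/-- The sign in `n = ± e₁ × e₂`: `n = e₁ ×_E e₂` in `E³`, `n = - e₁ ×_L e₂` in `L³`. -/
def gaussSign : SurfaceType → ℝ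
  | euclidean => 1
  | spacelike => -1
  | timelike => -1

/-- The ambient scalar product: `a₁b₁ + a₂b₂ + a₃b₃` in `E³`, `a₁b₁ + a₂b₂ - a₃b₃` in `L³`. -/
def ip (c : SurfaceType) (a b : R3) : ℝ :=
  a 0 * b 0 + a 1 * b 1 + c.ambientSign * (a 2 * b 2)

/-- The ambient vector product `a × ·` (Euclidean or Lorentzian), as a linear map. -/
def cross (c : SurfaceType) (a : R3) : R3 →ₗ[ℝ] R3 where
  toFun b := ![a 1 * b 2 - b 1 * a 2, a 2 * b 0 - b 2 * a 0,
    c.ambientSign * (a 0 * b 1 - b 0 * a 1)]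
  map_add' b b' := by
    ext i; fin_cases i <;> simp <;> ring
  map_smul' r b := by
    ext i; fin_cases i <;> simp <;> ring

/-- The ambient scalar product as a bilinear form. -/
def ipForm (c : SurfaceType) : R3 →ₗ[ℝ] R3 →ₗ[ℝ] ℝ :=
  LinearMap.mk₂ ℝ c.ip
    (fun a a' b => by simp [ip]; ring)
    (fun r a b => by simp [ip]; ring)
    (fun a b b' => by simp [ip]; ring)
    (fun r a b => by simp [ip]; ring)

end SurfaceType

/-- The oriented area of the parallelogram spanned by two vectors of the model plane. -/
def planeDet (v w : Plane) : ℝ := v 0 * w 1 - v 1 * w 0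

section Surface

variable {M : Type*} [TopologicalSpace M] [ChartedSpace Plane M]

/-- The `i`-th vector of the coordinate basis of `T_pM` given by the preferred chart at `p`. -/
def coordVec (p : M) (i : Fin 2) : TangentSpace (𝓡 2) p :=
  (EuclideanSpace.single i 1 : Plane)

variable (M) in
/-- An orientation of the surface `M`: a choice of orientation of every tangent plane, continuous in
the point. `sign p` is `1` if the coordinate basis of `T_pM` given by the preferred chart at `p` is
positively oriented, and `-1` otherwise. -/
structure SurfaceOrientation [IsManifold (𝓡 2) ∞ M] where
  sign : M → ℤˣ
  continuous' : ∀ p : M, ∀ᶠ q in 𝓝 p,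
    0 < ((sign p : ℤ) : ℝ) * ((sign q : ℤ) : ℝ) *
      LinearMap.det (tangentCoordChange (𝓡 2) q p q : Plane →ₗ[ℝ] Plane)

/-- The opposite orientation. -/
instance [IsManifold (𝓡 2) ∞ M] : Neg (SurfaceOrientation M) where
  neg o :=
    { sign := fun p => -o.sign p
      continuous' := fun p => (o.continuous' p).mono fun q hq => by simpa using hq }

/-- `(v, w)` is a positively oriented basis of `T_pM`. -/
def SurfaceOrientation.IsPositive [IsManifold (𝓡 2) ∞ M] (o : SurfaceOrientation M) (p : M)
    (v w : TangentSpace (𝓡 2) p) : Prop :=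
  0 < ((o.sign p : ℤ) : ℝ) * planeDet v w

variable (M) in
/-- `ℝ³`-valued differential 1-forms on `M` (no regularity required). -/
abbrev OneForm : Type _ := (p : M) → (TangentSpace (𝓡 2) p →L[ℝ] R3)

variable (M) in
/-- Fields of bilinear forms on the tangent planes of `M` (no regularity required). -/
abbrev BilinField : Type _ :=
  (p : M) → (TangentSpace (𝓡 2) p →ₗ[ℝ] TangentSpace (𝓡 2) p →ₗ[ℝ] ℝ)

/-- The differential of an `ℝ³`-valued function, as an `ℝ³`-valued 1-form. -/
def diff (f : M → R3) : OneForm M := fun p => mfderiv (𝓡 2) 𝓘(ℝ, R3) f p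

/-- The matrix of a bilinear form in the coordinate basis of `T_pM`. -/
def gram (g : BilinField M) (p : M) : Matrix (Fin 2) (Fin 2) ℝ :=
  Matrix.of fun i j => g p (coordVec p i) (coordVec p j)

/-- The components `α^i = ∑ j, g^{ij} α_j` of the 1-form `α` with the index raised by `g`. -/
def raise (g : BilinField M) (α : OneForm M) (p : M) (i : Fin 2) : R3 :=
  ∑ j, ((gram g p)⁻¹ i j) • α p (coordVec p j)

/-- The coefficient `± √|det g|` of the volume form of `g` in the coordinate basis of `T_pM`. -/
def volCoeff [IsManifold (𝓡 2) ∞ M] (g : BilinField M) (o : SurfaceOrientation M) (p : M) : ℝ :=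
  ((o.sign p : ℤ) : ℝ) * Real.sqrt |(gram g p).det|

/-- The Hodge star on 1-forms of a (Riemannian or Lorentzian) metric `g` on an oriented surface:
`*α = vol_g(α^♯, ·)`. Equivalently `β ∧ *α = g(β, α) vol_g`. For a positively oriented orthonormal
coframe, `*ω¹ = ω²` and `*ω² = -ω¹` if `g` is Riemannian, `*ω¹ = ω²` and `*ω² = ω¹` if
`g = (ω¹)² - (ω²)²`. -/
def hodgeStar [IsManifold (𝓡 2) ∞ M] (g : BilinField M) (o : SurfaceOrientation M)
    (α : OneForm M) : OneForm M := fun p =>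
  volCoeff g o p •
    ((EuclideanSpace.proj 1 : Plane →L[ℝ] ℝ).smulRight (raise g α p 0) -
      (EuclideanSpace.proj 0 : Plane →L[ℝ] ℝ).smulRight (raise g α p 1))

/-- The `ℝ³`-valued 1-form `dn + n × (*dn)`. -/
def kenmotsuForm [IsManifold (𝓡 2) ∞ M] (c : SurfaceType) (g : BilinField M)
    (o : SurfaceOrientation M) (n : M → R3) : OneForm M := fun p =>
  diff n p + (LinearMap.toContinuousLinearMap (c.cross (n p))).comp (hodgeStar g o (diff n) p)

/-- The metric (first fundamental form) induced on `M` by a map `x` to `E³` or `L³`. -/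
def inducedMetric (c : SurfaceType) (x : M → R3) : BilinField M := fun p =>
  c.ipForm.compl₁₂ (diff x p).toLinearMap (diff x p).toLinearMap

/-- A bilinear form on `T_pM` is positive definite. -/
def PosDefAt (g : BilinField M) (p : M) : Prop := ∀ v : TangentSpace (𝓡 2) p, v ≠ 0 → 0 < g p v v

/-- A symmetric bilinear form on the plane `T_pM` has signature `(+, -)`. -/
def LorentzAt (g : BilinField M) (p : M) : Prop :=
  (∃ v : TangentSpace (𝓡 2) p, 0 < g p v v) ∧ ∃ w : TangentSpace (𝓡 2) p, g p w w < 0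

/-- `x` is a smooth immersion into `E³`, a smooth spacelike immersion into `L³`, or a smooth timelike
immersion into `L³`, respectively. -/
def IsSurface (c : SurfaceType) (x : M → R3) : Prop :=
  ContMDiff (𝓡 2) 𝓘(ℝ, R3) ∞ x ∧ (∀ p, Function.Injective (diff x p)) ∧
    match c with
    | .euclidean => True
    | .spacelike => ∀ p, PosDefAt (inducedMetric c x) p
    | .timelike => ∀ p, LorentzAt (inducedMetric c x) p

/-- `(e₁, e₂)` is an orthonormal basis of `T_pM` for the metric induced by `x`, with `e₁` spacelike
and `e₂` timelike in the case of a timelike surface. -/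
def IsFrame (c : SurfaceType) (x : M → R3) (p : M) (e₁ e₂ : TangentSpace (𝓡 2) p) : Prop :=
  inducedMetric c x p e₁ e₁ = 1 ∧ inducedMetric c x p e₂ e₂ = c.frameSign ∧
    inducedMetric c x p e₁ e₂ = 0

/-- `n` is the Gauss map of the oriented surface `x`: for every positively oriented orthonormal
frame, `n = e₁ ×_E e₂` in `E³` and `n = - e₁ ×_L e₂` in `L³` (tangent vectors being identified with
their images under `dx`). -/
def IsGaussMap [IsManifold (𝓡 2) ∞ M] (c : SurfaceType) (o : SurfaceOrientation M)
    (x n : M → R3) : Prop :=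
  ∀ (p : M) (e₁ e₂ : TangentSpace (𝓡 2) p), IsFrame c x p e₁ e₂ → o.IsPositive p e₁ e₂ →
    n p = c.gaussSign • c.cross (diff x p e₁) (diff x p e₂)

/-- The second fundamental form `h(v, w) = -⟨dx(v), dn(w)⟩` of the surface `x` with respect to the
unit normal field `n`. -/
def secondForm (c : SurfaceType) (x n : M → R3) (p : M) (v w : TangentSpace (𝓡 2) p) : ℝ :=
  -c.ip (diff x p v) (diff n p w)

/-- `H` is the mean curvature function of the surface `x` with respect to the unit normal field `n`:
half of the trace of the second fundamental form with respect to the induced metric, that is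
`H = (h₁₁ + h₂₂) / 2` for spacelike and `H = (h₁₁ - h₂₂) / 2` for timelike surfaces, in orthonormal
frames. -/
def IsMeanCurvature (c : SurfaceType) (x n : M → R3) (H : M → ℝ) : Prop :=
  ∀ (p : M) (e₁ e₂ : TangentSpace (𝓡 2) p), IsFrame c x p e₁ e₂ →
    H p = (secondForm c x n p e₁ e₁ + c.frameSign * secondForm c x n p e₂ e₂) / 2

/-- `x = ∫ η`: the differential of `x` is `η`, and the increments of `x` are the line integrals of
`η` along `C¹` curves in `M`. -/
def IsIntegralOf (x : M → R3) (η : OneForm M) : Prop :=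
  (∀ p, HasMFDerivAt (𝓡 2) 𝓘(ℝ, R3) x p (η p)) ∧
  ∀ γ : ℝ → M, ContMDiff 𝓘(ℝ, ℝ) (𝓡 2) 1 γ → ∀ a b : ℝ,
    IntervalIntegrable (fun t => η (γ t) (mfderiv 𝓘(ℝ, ℝ) (𝓡 2) γ t (1 : ℝ)))
      MeasureTheory.volume a b ∧
    x (γ b) - x (γ a) = ∫ t in a..b, η (γ t) (mfderiv 𝓘(ℝ, ℝ) (𝓡 2) γ t (1 : ℝ))

/-- The differential at `y` of the inverse of the preferred chart at `p₀`: it sends the standard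
basis to the coordinate vector fields of that chart. -/
def chartFrame (p₀ : M) (y : Plane) :
    Plane →L[ℝ] TangentSpace (𝓡 2) ((extChartAt (𝓡 2) p₀).symm y) :=
  mfderiv 𝓘(ℝ, Plane) (𝓡 2) (extChartAt (𝓡 2) p₀).symm y

/-- The expression of a 1-form in the preferred chart at `p₀`, as an alternating form on the
plane. -/
def formInChart (η : OneForm M) (p₀ : M) (y : Plane) : Plane [⋀^Fin 1]→L[ℝ] R3 :=
  ContinuousAlternatingMap.ofSubsingleton ℝ Plane R3 0
    ((η ((extChartAt (𝓡 2) p₀).symm y)).comp (chartFrame p₀ y))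

/-- `dη = 0`, the exterior derivative being computed in charts. -/
def IsClosedForm (η : OneForm M) : Prop :=
  ∀ p₀ : M, ∀ y ∈ (extChartAt (𝓡 2) p₀).target, extDeriv (formInChart η p₀) y = 0

/-- `g` is a smooth metric on `M`: Riemannian in the first two situations, Lorentzian in the
third. -/
def IsMetric (c : SurfaceType) (g : BilinField M) : Prop :=
  (∀ p (v w : TangentSpace (𝓡 2) p), g p v w = g p w v) ∧
  (∀ (p₀ : M) (u v : Plane), ContDiffOn ℝ ∞
    (fun y => g ((extChartAt (𝓡 2) p₀).symm y) (chartFrame p₀ y u) (chartFrame p₀ y v))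
    (extChartAt (𝓡 2) p₀).target) ∧
  match c with
  | .euclidean => ∀ p, PosDefAt g p
  | .spacelike => ∀ p, PosDefAt g p
  | .timelike => ∀ p, LorentzAt g p

/-- The non-degeneracy condition on a 1-form: it vanishes at no point; in the timelike case, where
a non-zero value may have rank one, it is injective at every point. -/
def IsNondegenerate (c : SurfaceType) (η : OneForm M) : Prop :=
  match c with
  | .euclidean => ∀ p, η p ≠ 0
  | .spacelike => ∀ p, η p ≠ 0
  | .timelike => ∀ p, Function.Injective (η p)

end Surface

end Kenmotsu

end

/-!
A linear map `T` from an oriented tangent plane into `ℝ³` is called conformal with normal `n` if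
it takes the quarter turn `J` of the plane to `n × ·`. Up to sign `*α = α ∘ J`, and since the
squares of `J` and of `n × ·` on `n^⊥` are the same sign, `dn + n × *dn` is twice the conformal
part of `dn` for every `n` with `⟨n, n⟩ = ±1`. If `n` is the Gauss map of `x`, then `dx` is
conformal with normal `n`, so `dn + n × *dn` has the form `a dx + b n × dx`: by the symmetry of
the second fundamental form `b = 0`, and taking traces `a = -2H`. Conversely, a primitive `x` of
`-φ/(2H)`, where `φ = dn + n × *dn`, has conformal differential, so its induced metric is `m g`
for a function `m`. Nondegeneracy makes `m` nonzero, and positive in the definite cases; in the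
Lorentzian case `m` has constant sign, and if it is negative the induced metric has the opposite
causal character, which exchanges the roles of the two frame vectors and hence reverses the
orientation.
-/

noncomputable section

namespace Kenmotsu

/-! ### The ambient scalar and vector products -/

namespace SurfaceType

variable (c : SurfaceType)

theorem frameSign_mul_self : c.frameSign * c.frameSign = 1 := by
  cases c <;> simp [frameSign]

theorem ambientSign_mul_self : c.ambientSign * c.ambientSign = 1 := by
  cases c <;> simp [ambientSign]

theorem gaussSign_eq_ambientSign : c.gaussSign = c.ambientSign := by
  cases c <;> rfl

theorem ambientSign_mul_normalSign : c.ambientSign * c.normalSign = c.frameSign := by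
  cases c <;> simp [ambientSign, normalSign, frameSign]

theorem ip_comm (a b : R3) : c.ip a b = c.ip b a := by
  simp only [ip]; ring

theorem ip_add_left (a a' b : R3) : c.ip (a + a') b = c.ip a b + c.ip a' b :=
  c.ipForm.map_add₂ a a' b

theorem ip_sub_left (a a' b : R3) : c.ip (a - a') b = c.ip a b - c.ip a' b :=
  c.ipForm.map_sub₂ a a' b

theorem ip_smul_left (r : ℝ) (a b : R3) : c.ip (r • a) b = r * c.ip a b :=
  c.ipForm.map_smul₂ r a b

theorem ip_add_right (a b b' : R3) : c.ip a (b + b') = c.ip a b + c.ip a b' :=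
  map_add (c.ipForm a) b b'

theorem ip_smul_right (r : ℝ) (a b : R3) : c.ip a (r • b) = r * c.ip a b :=
  map_smul (c.ipForm a) r b

theorem cross_apply (a b : R3) :
    c.cross a b = ![a 1 * b 2 - b 1 * a 2, a 2 * b 0 - b 2 * a 0,
      c.ambientSign * (a 0 * b 1 - b 0 * a 1)] := rfl

theorem cross_smul_left (r : ℝ) (a b : R3) : c.cross (r • a) b = r • c.cross a b := by
  ext i; fin_cases i <;> (simp [cross_apply]; ring)

theorem cross_anticomm (a b : R3) : c.cross a b = -c.cross b a := by
  ext i; fin_cases i <;> simp [cross_apply]; ring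

theorem cross_cross (a b w : R3) :
    c.cross a (c.cross b w) = c.ambientSign • (c.ip a w • b - c.ip a b • w) := by
  ext i; cases c <;> fin_cases i <;> simp [cross_apply, ip, ambientSign] <;> ring

theorem ip_cross_left (n u w : R3) : c.ip (c.cross n u) w = -c.ip u (c.cross n w) := by
  cases c <;> simp [cross_apply, ip, ambientSign] <;> ring

theorem ip_cross_self (n u : R3) : c.ip (c.cross n u) n = 0 := by
  cases c <;> simp [cross_apply, ip, ambientSign] <;> ring

theorem ip_cross_cross (u w : R3) :
    c.ip (c.cross u w) (c.cross u w) =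
      c.ambientSign * (c.ip u u * c.ip w w - c.ip u w * c.ip u w) := by
  cases c <;> simp [cross_apply, ip, ambientSign] <;> ring

theorem cross_ne_zero_of_linearIndependent {a b : R3} (h : LinearIndependent ℝ ![a, b]) :
    c.cross a b ≠ 0 := by
  refine fun h0 => crossProduct_ne_zero_iff_linearIndependent.2 h ?_
  ext i
  have hi := congrFun h0 i
  cases c <;> fin_cases i <;>
    simp [cross_apply, _root_.cross_apply, ambientSign] at hi ⊢ <;> linarith

variable {c} {n w : R3}

theorem cross_cross_normal (hn : c.ip n n = c.normalSign) (hw : c.ip w n = 0) :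
    c.cross n (c.cross n w) = -c.frameSign • w := by
  rw [cross_cross, ip_comm c n w, hw, hn, zero_smul, zero_sub, smul_neg, smul_smul,
    ambientSign_mul_normalSign, neg_smul]

theorem ip_cross_normal (u : R3) (hn : c.ip n n = c.normalSign) (hw : c.ip w n = 0) :
    c.ip (c.cross n u) (c.cross n w) = c.frameSign * c.ip u w := by
  rw [ip_cross_left, cross_cross_normal hn hw, ip_smul_right]; ring

theorem sq_mul_ip_self_spacelike (hn : spacelike.ip n n = -1) (hw : spacelike.ip w n = 0) :
    n 2 ^ 2 * spacelike.ip w w = w 0 ^ 2 + w 1 ^ 2 + (w 0 * n 1 - w 1 * n 0) ^ 2 := by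
  simp only [ip, ambientSign] at hn hw ⊢
  linear_combination -(w 0 ^ 2 + w 1 ^ 2) * hn + (w 0 * n 0 + w 1 * n 1 + w 2 * n 2) * hw

theorem ip_euclidean_self_pos (hw : w ≠ 0) : 0 < euclidean.ip w w := by
  simp only [ip, ambientSign]
  contrapose! hw
  ext i
  fin_cases i
  exacts [(by nlinarith : w 0 = 0), (by nlinarith : w 1 = 0), (by nlinarith : w 2 = 0)]

/-- For the spacelike case this is the reversed Cauchy–Schwarz inequality: the orthogonal complement
of a timelike vector is spacelike. -/
theorem ip_self_pos (hc : c.frameSign = 1) (hn : c.ip n n = c.normalSign) (hw : c.ip w n = 0)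
    (h0 : w ≠ 0) : 0 < c.ip w w := by
  cases c
  · exact ip_euclidean_self_pos h0
  · have hsq := sq_mul_ip_self_spacelike hn hw
    simp only [ip, ambientSign, normalSign] at hn hw
    have hn2 : 0 < n 2 ^ 2 := by nlinarith [sq_nonneg (n 0), sq_nonneg (n 1)]
    refine pos_of_mul_pos_right (hsq ▸ ?_) hn2.le
    by_contra! hle
    have h00 : w 0 = 0 := by nlinarith [sq_nonneg (w 0 * n 1 - w 1 * n 0)]
    have h11 : w 1 = 0 := by nlinarith [sq_nonneg (w 0 * n 1 - w 1 * n 0)]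
    have hn2' : n 2 ≠ 0 := fun h => by simp [h] at hn2
    have h22 : w 2 = 0 := by simpa [h00, h11, hn2'] using hw
    exact h0 (by ext i; fin_cases i <;> simp [h00, h11, h22])
  · norm_num [frameSign] at hc

theorem frame_relations {X Y : R3} (hX : c.ip X X = 1) (hY : c.ip Y Y = c.frameSign)
    (hXY : c.ip X Y = 0) (hn : n = c.gaussSign • c.cross X Y) :
    c.ip n n = c.normalSign ∧ c.ip X n = 0 ∧ c.ip Y n = 0 ∧ c.cross n X = Y ∧
      c.cross n Y = -c.frameSign • X := by
  rw [gaussSign_eq_ambientSign] at hn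
  subst hn
  refine ⟨?_, ?_, ?_, ?_, ?_⟩
  · rw [ip_smul_left, ip_smul_right, ip_cross_cross, hX, hY, hXY]
    linear_combination c.ambientSign * c.frameSign * c.ambientSign_mul_self -
      c.ambientSign * c.ambientSign_mul_normalSign + c.normalSign * c.ambientSign_mul_self
  · rw [ip_smul_right, ip_comm, ip_cross_self, mul_zero]
  · rw [ip_smul_right, ip_comm, cross_anticomm, ← neg_one_smul ℝ, ip_smul_left, ip_cross_self]
    ring
  · rw [cross_smul_left, cross_anticomm, cross_cross, hX, hXY, zero_smul, zero_sub, one_smul]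
    simp [smul_smul, ambientSign_mul_self]
  · rw [cross_smul_left, cross_anticomm, cross_cross, hY, ip_comm, hXY, zero_smul, sub_zero,
      smul_neg, smul_smul, ambientSign_mul_self, one_smul, neg_smul]

theorem ip_self_smul_eq_cross_cross (hw : c.ip w n = 0) :
    c.ip w w • n = c.gaussSign • c.cross w (c.cross n w) := by
  rw [cross_cross, hw, gaussSign_eq_ambientSign, smul_smul, ambientSign_mul_self, zero_smul,
    sub_zero, one_smul]

theorem eq_zero_of_ip_eq_zero {X Y : R3} (hn : n = c.gaussSign • c.cross X Y)
    (hnn : c.ip n n = c.normalSign) (hwn : c.ip w n = 0) (hwX : c.ip w X = 0)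
    (hwY : c.ip w Y = 0) : w = 0 := by
  have hnw : c.cross n w = 0 := by
    rw [hn, cross_smul_left, cross_anticomm, cross_cross, hwX, hwY]
    simp
  have h := cross_cross_normal hnn hwn
  rw [hnw, map_zero, eq_comm, neg_smul, neg_eq_zero] at h
  exact (smul_eq_zero_iff_right (left_ne_zero_of_mul_eq_one c.frameSign_mul_self)).1 h

end SurfaceType

/-! ### The quarter turn of an oriented scalar product on the plane -/

/-- Bilinear forms on the model plane. -/
abbrev PlaneForm : Type := Plane →ₗ[ℝ] Plane →ₗ[ℝ] ℝ

/-- The first vector of the standard basis of the model plane. -/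
def E₀ : Plane := EuclideanSpace.single 0 1

/-- The second vector of the standard basis of the model plane. -/
def E₁ : Plane := EuclideanSpace.single 1 1

theorem eq_smul_add_smul (v : Plane) : v = v 0 • E₀ + v 1 • E₁ := by
  ext i; fin_cases i <;> simp [E₀, E₁]

/-- Cramer's rule. -/
theorem planeDet_smul_eq (u w v : Plane) :
    planeDet u w • v = planeDet v w • u + planeDet u v • w := by
  ext i; fin_cases i <;> simp [planeDet] <;> ring

theorem planeDet_swap (v w : Plane) : planeDet v w = -planeDet w v := by
  simp only [planeDet]; ring

theorem eq_of_planeDet_eq {v w : Plane} (h : ∀ a, planeDet a v = planeDet a w) : v = w := by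
  ext i
  fin_cases i
  · simpa [planeDet, E₁] using h E₁
  · simpa [planeDet, E₀] using h E₀

theorem planeDet_map_map (L : Plane →L[ℝ] Plane) (v w : Plane) :
    planeDet (L v) (L w) = planeDet (L E₀) (L E₁) * planeDet v w := by
  conv_lhs => rw [eq_smul_add_smul v, eq_smul_add_smul w]
  simp only [map_add, map_smul, planeDet, PiLp.add_apply, PiLp.smul_apply, smul_eq_mul]
  ring

theorem linearIndependent_of_planeDet_ne_zero {u w : Plane} (h : planeDet u w ≠ 0) :
    LinearIndependent ℝ ![u, w] := by
  refine LinearIndependent.pair_iff.2 fun a b hab => ⟨?_, ?_⟩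
  · refine (mul_eq_zero_iff_right h).1 ?_
    have := congrArg (planeDet · w) hab
    simp only [planeDet, PiLp.add_apply, PiLp.smul_apply, PiLp.zero_apply, smul_eq_mul] at this ⊢
    linear_combination this
  · refine (mul_eq_zero_iff_right h).1 ?_
    have := congrArg (planeDet u ·) hab
    simp only [planeDet, PiLp.add_apply, PiLp.smul_apply, PiLp.zero_apply, smul_eq_mul] at this ⊢
    linear_combination this

theorem ext_of_planeDet_ne_zero {F : Type*} [AddCommGroup F] [Module ℝ F] [TopologicalSpace F]
    {S T : Plane →L[ℝ] F} {u w : Plane} (h : planeDet u w ≠ 0) (hu : S u = T u)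
    (hw : S w = T w) : S = T := by
  ext1 v
  have hv : planeDet u w • S v = planeDet u w • T v := by
    rw [← map_smul, ← map_smul, planeDet_smul_eq, map_add, map_add, map_smul, map_smul, map_smul,
      map_smul, hu, hw]
  exact (smul_right_injective F h) hv

/-- The Gram determinant of two vectors with respect to a symmetric bilinear form. -/
def gramDet (G : PlaneForm) (u w : Plane) : ℝ := G u u * G w w - G u w * G u w

theorem gramDet_eq {G : PlaneForm} (hG : ∀ v w, G v w = G w v) (u w : Plane) :
    gramDet G u w = planeDet u w ^ 2 * gramDet G E₀ E₁ := by
  have expand (a b : Plane) : G a b = a 0 * b 0 * G E₀ E₀ + a 0 * b 1 * G E₀ E₁ +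
      a 1 * b 0 * G E₀ E₁ + a 1 * b 1 * G E₁ E₁ := by
    conv_lhs => rw [eq_smul_add_smul a, eq_smul_add_smul b]
    simp only [map_add, map_smul, LinearMap.add_apply, LinearMap.smul_apply, smul_eq_mul, hG E₁ E₀]
    ring
  simp only [gramDet, planeDet, expand u, expand w]
  ring

theorem gramDet_smul (m : ℝ) (G : PlaneForm) (u w : Plane) :
    gramDet (m • G) u w = m ^ 2 * gramDet G u w := by
  simp only [gramDet, LinearMap.smul_apply, smul_eq_mul]; ring

theorem cast_sign_mul_self (s : ℤˣ) : ((s : ℤ) : ℝ) * (s : ℤ) = 1 := by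
  norm_cast; exact Int.units_coe_mul_self s

theorem sign_div_sqrt_mul {s s' : ℤˣ} {r : ℝ} (h : 0 < ((s' : ℤ) : ℝ) * ((s : ℤ) * r)) (D : ℝ) :
    ((s' : ℤ) / √|r ^ 2 * D| : ℝ) * r = (s : ℤ) / √|D| := by
  have hr : |r| = (s' : ℤ) * ((s : ℤ) * r) := by
    rw [← abs_of_pos h]
    rcases Int.units_eq_one_or s with rfl | rfl <;>
      rcases Int.units_eq_one_or s' with rfl | rfl <;> simp
  have hr0 : r ≠ 0 := by rintro rfl; simp at h
  rw [abs_mul, abs_pow, Real.sqrt_mul (by positivity), Real.sqrt_sq (abs_nonneg r), mul_comm |r|,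
    ← div_div, div_mul_eq_mul_div, div_mul_eq_mul_div, div_eq_iff (abs_ne_zero.2 hr0), hr]
  linear_combination (-r * (s' : ℤ) / √|D| : ℝ) * cast_sign_mul_self s

/-- The rotation by a right angle of the plane with scalar product `G` and orientation `s`: the
operator `J` with `vol(v, J w) = G(v, w)`, where `vol` is the volume form of `G`. It satisfies
`J² = -1` for a definite and `J² = 1` for an indefinite `G`, and the Hodge star of a 1-form `α` is
`-α ∘ J` and `α ∘ J`, respectively. -/
def quarterTurn (G : PlaneForm) (s : ℤˣ) : Plane →L[ℝ] Plane :=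
  ((s : ℤ) / √|gramDet G E₀ E₁| : ℝ) • LinearMap.toContinuousLinearMap
    ((G.flip E₀).smulRight E₁ - (G.flip E₁).smulRight E₀)

section QuarterTurn

variable {G : PlaneForm} {s : ℤˣ}

theorem quarterTurn_apply (G : PlaneForm) (s : ℤˣ) (v : Plane) :
    quarterTurn G s v =
      ((s : ℤ) / √|gramDet G E₀ E₁| : ℝ) • (G v E₀ • E₁ - G v E₁ • E₀) := rfl

theorem planeDet_quarterTurn (G : PlaneForm) (s : ℤˣ) (a v : Plane) :
    planeDet a (quarterTurn G s v) = (s : ℤ) / √|gramDet G E₀ E₁| * G v a := by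
  conv_rhs => rw [eq_smul_add_smul a]
  simp [quarterTurn_apply, planeDet, E₀, E₁]
  ring

theorem planeDet_smul_quarterTurn (G : PlaneForm) (s : ℤˣ) (u w v : Plane) :
    planeDet u w • quarterTurn G s v =
      ((s : ℤ) / √|gramDet G E₀ E₁| : ℝ) • (G v u • w - G v w • u) := by
  rw [planeDet_smul_eq, planeDet_swap _ w, planeDet_quarterTurn, planeDet_quarterTurn]
  module

theorem quarterTurn_smul {m : ℝ} {s' : ℤˣ} (h : 0 < ((s' : ℤ) : ℝ) * ((s : ℤ) * m)) :
    quarterTurn (m • G) s' = quarterTurn G s := by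
  ext1 v
  rw [quarterTurn_apply, quarterTurn_apply, gramDet_smul, ← sign_div_sqrt_mul h, mul_smul]
  simp only [LinearMap.smul_apply, smul_assoc, smul_sub]

theorem map_quarterTurn (L : Plane →L[ℝ] Plane) (hG : ∀ v w, G v w = G w v) {s' : ℤˣ}
    (h : 0 < ((s' : ℤ) : ℝ) * ((s : ℤ) * planeDet (L E₀) (L E₁))) (v : Plane) :
    L (quarterTurn (G.compl₁₂ L.toLinearMap L.toLinearMap) s' v) = quarterTurn G s (L v) := by
  set δ := planeDet (L E₀) (L E₁) with hδ
  have hδ0 : δ ≠ 0 := fun h0 => by simp [h0] at h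
  have hD : gramDet (G.compl₁₂ L.toLinearMap L.toLinearMap) E₀ E₁ = δ ^ 2 * gramDet G E₀ E₁ :=
    gramDet_eq hG (L E₀) (L E₁)
  have hL (a : Plane) :
      planeDet (L a) (L (quarterTurn (G.compl₁₂ L.toLinearMap L.toLinearMap) s' v)) =
        planeDet (L a) (quarterTurn G s (L v)) := by
    rw [planeDet_map_map, planeDet_quarterTurn, planeDet_quarterTurn, hD, ← hδ,
      ← sign_div_sqrt_mul h]
    simp only [LinearMap.compl₁₂_apply, ContinuousLinearMap.coe_coe]
    ring
  refine eq_of_planeDet_eq fun a => mul_left_cancel₀ hδ0 ?_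
  have key (z : Plane) : δ * planeDet a z =
      planeDet a (L E₁) * planeDet (L E₀) z + planeDet (L E₀) a * planeDet (L E₁) z := by
    simp only [hδ, planeDet]; ring
  rw [key, key, hL, hL]

/-- `G` is symmetric and has the signature of the induced metric of a surface of type `c`. -/
structure HasSignature (c : SurfaceType) (G : PlaneForm) : Prop where
  symm : ∀ v w, G v w = G w v
  exists_pos : ∃ v, 0 < G v v
  det_pos : 0 < c.frameSign * gramDet G E₀ E₁

/-- `(e₁, e₂)` is an orthonormal frame of `G`, with `e₂` timelike if `c` is. -/
def IsOrthonormal (c : SurfaceType) (G : PlaneForm) (e₁ e₂ : Plane) : Prop :=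
  G e₁ e₁ = 1 ∧ G e₂ e₂ = c.frameSign ∧ G e₁ e₂ = 0

variable {c : SurfaceType} {e₁ e₂ : Plane}

namespace HasSignature

theorem abs_gramDet (hG : HasSignature c G) :
    |gramDet G E₀ E₁| = c.frameSign * gramDet G E₀ E₁ := by
  rw [← abs_of_pos hG.det_pos, abs_mul]; cases c <;> simp [SurfaceType.frameSign]

theorem gramDet_ne_zero (hG : HasSignature c G) : gramDet G E₀ E₁ ≠ 0 :=
  right_ne_zero_of_mul hG.det_pos.ne'

theorem quarterTurn_quarterTurn (hG : HasSignature c G) (v : Plane) :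
    quarterTurn G s (quarterTurn G s v) = -c.frameSign • v := by
  have hk : ((s : ℤ) / √|gramDet G E₀ E₁| : ℝ) ^ 2 * gramDet G E₀ E₁ = c.frameSign := by
    have hD0 := hG.gramDet_ne_zero
    have hε0 : c.frameSign ≠ 0 := left_ne_zero_of_mul hG.det_pos.ne'
    rw [div_pow, Real.sq_sqrt (abs_nonneg _), hG.abs_gramDet, sq, cast_sign_mul_self]
    field_simp
    rw [sq, c.frameSign_mul_self]
  have hv (w : Plane) : G v w = v 0 * G E₀ w + v 1 * G E₁ w := by
    conv_lhs => rw [eq_smul_add_smul v]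
    simp
  rw [quarterTurn_apply, quarterTurn_apply, ← hk, gramDet]
  generalize ((s : ℤ) / √|gramDet G E₀ E₁| : ℝ) = _k
  simp only [map_smul, map_sub, LinearMap.smul_apply, LinearMap.sub_apply, smul_eq_mul, hv,
    hG.symm E₁ E₀]
  conv_rhs => rw [eq_smul_add_smul v]
  module

theorem apply_quarterTurn (hG : HasSignature c G) (v w : Plane) :
    G v (quarterTurn G s w) = -G (quarterTurn G s v) w := by
  have hk : ((s : ℤ) / √|gramDet G E₀ E₁| : ℝ) ≠ 0 := by
    have hD := hG.gramDet_ne_zero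
    have hs := left_ne_zero_of_mul_eq_one (cast_sign_mul_self s)
    positivity
  refine mul_left_cancel₀ hk ?_
  rw [← planeDet_quarterTurn, mul_neg, hG.symm _ w, ← planeDet_quarterTurn, planeDet_swap]

theorem exists_isOrthonormal (hG : HasSignature c G) (s : ℤˣ) :
    ∃ e₁ e₂, IsOrthonormal c G e₁ e₂ ∧ 0 < ((s : ℤ) : ℝ) * planeDet e₁ e₂ := by
  obtain ⟨v, hv⟩ := hG.exists_pos
  have h1 : G ((√(G v v))⁻¹ • v) ((√(G v v))⁻¹ • v) = 1 := by
    have := Real.mul_self_sqrt hv.le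
    have := (Real.sqrt_pos.2 hv).ne'
    simp only [map_smul, LinearMap.smul_apply, smul_eq_mul]
    field_simp
    linarith
  generalize (√(G v v))⁻¹ • v = e at h1
  have h0 : G e (quarterTurn G s e) = 0 := by
    have := hG.apply_quarterTurn (s := s) e e
    rw [hG.symm _ e] at this
    linarith
  refine ⟨e, quarterTurn G s e, ⟨h1, ?_, h0⟩, ?_⟩
  · rw [hG.apply_quarterTurn, hG.quarterTurn_quarterTurn, map_smul, LinearMap.smul_apply, h1]
    simp
  · have hD := abs_pos.2 hG.gramDet_ne_zero
    rw [planeDet_quarterTurn, h1, mul_one, mul_div_assoc', cast_sign_mul_self]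
    positivity

end HasSignature

namespace IsOrthonormal

theorem planeDet_sq_mul (h : IsOrthonormal c G e₁ e₂) (hG : ∀ v w, G v w = G w v) :
    planeDet e₁ e₂ ^ 2 * gramDet G E₀ E₁ = c.frameSign := by
  rw [← gramDet_eq hG, gramDet, h.1, h.2.1, h.2.2]; ring

theorem planeDet_ne_zero (h : IsOrthonormal c G e₁ e₂) (hG : ∀ v w, G v w = G w v) :
    planeDet e₁ e₂ ≠ 0 := by
  intro h0
  have := h.planeDet_sq_mul hG
  cases c <;> simp [h0, SurfaceType.frameSign] at this

theorem neg_right (h : IsOrthonormal c G e₁ e₂) : IsOrthonormal c G e₁ (-e₂) :=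
  ⟨h.1, by simpa using h.2.1, by simpa using h.2.2⟩

theorem quarterTurn_apply (h : IsOrthonormal c G e₁ e₂) (hG : ∀ v w, G v w = G w v)
    (hs : 0 < ((s : ℤ) : ℝ) * planeDet e₁ e₂) (v : Plane) :
    quarterTurn G s v = G v e₁ • e₂ - G v e₂ • e₁ := by
  have hk : planeDet e₁ e₂ = (s : ℤ) / √|gramDet G E₀ E₁| := by
    rw [← sign_div_sqrt_mul (s' := 1) (by simpa using hs), h.planeDet_sq_mul hG]
    cases c <;> simp [SurfaceType.frameSign]
  refine smul_right_injective Plane (h.planeDet_ne_zero hG) ?_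
  simp only [planeDet_smul_quarterTurn, ← hk]

theorem quarterTurn_left (h : IsOrthonormal c G e₁ e₂) (hG : ∀ v w, G v w = G w v)
    (hs : 0 < ((s : ℤ) : ℝ) * planeDet e₁ e₂) : quarterTurn G s e₁ = e₂ := by
  rw [h.quarterTurn_apply hG hs, h.1, h.2.2, one_smul, zero_smul, sub_zero]

theorem quarterTurn_right (h : IsOrthonormal c G e₁ e₂) (hG : ∀ v w, G v w = G w v)
    (hs : 0 < ((s : ℤ) : ℝ) * planeDet e₁ e₂) : quarterTurn G s e₂ = -c.frameSign • e₁ := by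
  rw [h.quarterTurn_apply hG hs, hG, h.2.1, h.2.2, zero_smul, zero_sub, neg_smul]

theorem eq_smul_add_smul (h : IsOrthonormal c G e₁ e₂) (hG : ∀ v w, G v w = G w v) (v : Plane) :
    v = G v e₁ • e₁ + (c.frameSign * G v e₂) • e₂ := by
  have hd := h.planeDet_ne_zero hG
  obtain ⟨a, b, rfl⟩ : ∃ a b : ℝ, v = a • e₁ + b • e₂ := by
    refine ⟨planeDet v e₂ / planeDet e₁ e₂, planeDet e₁ v / planeDet e₁ e₂,
      smul_right_injective Plane hd ?_⟩
    simp only [planeDet_smul_eq e₁ e₂ v, smul_add, smul_smul, mul_div_cancel₀ _ hd]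
  simp only [map_add, map_smul, LinearMap.add_apply, LinearMap.smul_apply, smul_eq_mul, h.1, h.2.1,
    h.2.2, hG e₂ e₁]
  rw [show c.frameSign * (a * 0 + b * c.frameSign) = b by
    linear_combination b * c.frameSign_mul_self]
  simp

theorem apply_self (h : IsOrthonormal c G e₁ e₂) (hG : ∀ v w, G v w = G w v) (v : Plane) :
    G v v = G v e₁ ^ 2 + c.frameSign * G v e₂ ^ 2 := by
  conv_lhs => rw [h.eq_smul_add_smul hG v]
  simp only [map_add, map_smul, LinearMap.add_apply, LinearMap.smul_apply, smul_eq_mul, h.1, h.2.1,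
    h.2.2, hG e₂ e₁]
  linear_combination c.frameSign * G v e₂ ^ 2 * c.frameSign_mul_self

end IsOrthonormal

theorem HasSignature.smul (hG : HasSignature c G) {m : ℝ} (hm : m ≠ 0)
    (hpos : c.frameSign = 1 → 0 < m) : HasSignature c (m • G) where
  symm v w := congrArg (m * ·) (hG.symm v w)
  exists_pos := by
    rcases hm.lt_or_gt with h | h
    · obtain ⟨e₁, e₂, he, -⟩ := hG.exists_isOrthonormal 1
      have hc : c.frameSign = -1 :=
        (mul_self_eq_one_iff.1 c.frameSign_mul_self).resolve_left fun hc => (hpos hc).not_gt h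
      exact ⟨e₂, by simpa [he.2.1, hc] using h⟩
    · exact hG.exists_pos.imp fun v hv => mul_pos h hv
  det_pos := by
    rw [gramDet_smul, mul_left_comm]
    exact mul_pos (sq_pos_of_ne_zero hm) hG.det_pos

theorem hasSignature_iff_posDef (hc : c.frameSign = 1) (hG : ∀ v w, G v w = G w v) :
    HasSignature c G ↔ ∀ v, v ≠ 0 → 0 < G v v := by
  constructor
  · intro h v hv
    obtain ⟨e₁, e₂, he, -⟩ := h.exists_isOrthonormal 1
    rw [he.apply_self hG, hc, one_mul]
    by_contra! hle
    have h1 : G v e₁ = 0 := by nlinarith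
    have h2 : G v e₂ = 0 := by nlinarith
    exact hv (by rw [he.eq_smul_add_smul hG v, h1, h2]; simp)
  · intro h
    have hE₀ : 0 < G E₀ E₀ :=
      h _ fun h0 => by simpa [E₀] using congrArg (fun v : Plane => v 0) h0
    refine ⟨hG, ⟨E₀, hE₀⟩, ?_⟩
    have hpos := h (G E₀ E₀ • E₁ - G E₀ E₁ • E₀) fun h0 =>
      hE₀.ne' (by simpa [E₀, E₁] using congrArg (fun v : Plane => v 1) h0)
    simp only [map_sub, map_smul, LinearMap.sub_apply, LinearMap.smul_apply, smul_eq_mul,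
      hG E₁ E₀] at hpos
    rw [hc, one_mul, gramDet]
    refine pos_of_mul_pos_right (a := G E₀ E₀) (lt_of_lt_of_eq hpos ?_) hE₀.le
    ring

theorem hasSignature_timelike_iff (hG : ∀ v w, G v w = G w v) :
    HasSignature .timelike G ↔ (∃ v, 0 < G v v) ∧ ∃ w, G w w < 0 := by
  constructor
  · intro h
    obtain ⟨e₁, e₂, he, -⟩ := h.exists_isOrthonormal 1
    exact ⟨h.exists_pos, e₂, by rw [he.2.1]; norm_num [SurfaceType.frameSign]⟩
  · rintro ⟨⟨v, hv⟩, w, hw⟩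
    refine ⟨hG, ⟨v, hv⟩, ?_⟩
    have h1 : gramDet G v w < 0 := by
      rw [gramDet]; nlinarith [mul_pos_of_neg_of_neg hw (neg_neg_of_pos hv)]
    rw [gramDet_eq hG] at h1
    simpa [SurfaceType.frameSign] using neg_of_mul_neg_right h1 (sq_nonneg _)

end QuarterTurn

/-! ### Conformal linear maps with a given normal -/

/-- The value at a tangent plane with scalar product `G` and orientation `s` of the form
`dn + n × *dn`, where `A` stands for `dn`. -/
def kenmotsuAt (c : SurfaceType) (G : PlaneForm) (s : ℤˣ) (n : R3) (A : Plane →L[ℝ] R3) :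
    Plane →L[ℝ] R3 :=
  A - c.frameSign • (c.cross n).toContinuousLinearMap ∘L A ∘L quarterTurn G s

/-- `T` is a conformal map from the oriented plane `(G, s)` to the plane with oriented normal `n`:
it carries the quarter turn to `n × ·`. The conformal factor may vanish and, if `G` is indefinite,
be negative. -/
structure IsConformal (c : SurfaceType) (G : PlaneForm) (s : ℤˣ) (n : R3) (T : Plane →L[ℝ] R3) :
    Prop where
  normal : ∀ v, c.ip (T v) n = 0
  map_quarterTurn : ∀ v, T (quarterTurn G s v) = c.cross n (T v)

section Conformal

variable {c : SurfaceType} {G : PlaneForm} {s : ℤˣ} {n : R3} {T A : Plane →L[ℝ] R3}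
  {e₁ e₂ : Plane}

theorem kenmotsuAt_apply (v : Plane) :
    kenmotsuAt c G s n A v = A v - c.frameSign • c.cross n (A (quarterTurn G s v)) := rfl

theorem kenmotsuAt_comp (hG : ∀ v w, G v w = G w v) (L : Plane →L[ℝ] Plane) {s' : ℤˣ}
    (h : 0 < ((s' : ℤ) : ℝ) * ((s : ℤ) * planeDet (L E₀) (L E₁))) :
    kenmotsuAt c G s n A ∘L L =
      kenmotsuAt c (G.compl₁₂ L.toLinearMap L.toLinearMap) s' n (A ∘L L) := by
  ext1 v
  rw [kenmotsuAt_apply, ContinuousLinearMap.comp_apply, kenmotsuAt_apply,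
    ContinuousLinearMap.comp_apply, ContinuousLinearMap.comp_apply, map_quarterTurn L hG h]

theorem isConformal_kenmotsuAt (hG : HasSignature c G) (hn : c.ip n n = c.normalSign)
    (hA : ∀ v, c.ip (A v) n = 0) : IsConformal c G s n (kenmotsuAt c G s n A) where
  normal v := by
    rw [kenmotsuAt_apply, c.ip_sub_left, c.ip_smul_left, c.ip_cross_self, hA, mul_zero, sub_zero]
  map_quarterTurn v := by
    rw [kenmotsuAt_apply, kenmotsuAt_apply, hG.quarterTurn_quarterTurn, map_smul, map_smul,
      map_sub, map_smul, SurfaceType.cross_cross_normal hn (hA _), smul_smul, smul_smul, mul_neg,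
      c.frameSign_mul_self]
    module

theorem isConformal_of_eq_cross (he : IsOrthonormal c G e₁ e₂)
    (hGT : ∀ v w, G v w = c.ip (T v) (T w)) (hs : 0 < ((s : ℤ) : ℝ) * planeDet e₁ e₂)
    (hn : n = c.gaussSign • c.cross (T e₁) (T e₂)) :
    c.ip n n = c.normalSign ∧ IsConformal c G s n T := by
  have hG (v w : Plane) : G v w = G w v := by rw [hGT, hGT, c.ip_comm]
  have hd := he.planeDet_ne_zero hG
  obtain ⟨hnn, h1, h2, hT1, hT2⟩ := SurfaceType.frame_relations ((hGT _ _).symm.trans he.1)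
    ((hGT _ _).symm.trans he.2.1) ((hGT _ _).symm.trans he.2.2) hn
  refine ⟨hnn, fun v => ?_, fun v => ?_⟩
  · rw [he.eq_smul_add_smul hG v, map_add, map_smul, map_smul, c.ip_add_left, c.ip_smul_left,
      c.ip_smul_left, h1, h2, mul_zero, mul_zero, add_zero]
  · have h : T ∘L quarterTurn G s = (c.cross n).toContinuousLinearMap ∘L T :=
      ext_of_planeDet_ne_zero hd
        (by simp [he.quarterTurn_left hG hs, hT1])
        (by simp [he.quarterTurn_right hG hs, hT2])
    exact congr($h v)

namespace IsConformal

theorem ip_self_smul_eq_cross (hT : IsConformal c G s n T) (v : Plane) :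
    c.ip (T v) (T v) • n = c.gaussSign • c.cross (T v) (T (quarterTurn G s v)) := by
  rw [hT.map_quarterTurn, SurfaceType.ip_self_smul_eq_cross_cross (hT.normal v)]

theorem eq_cross (hT : IsConformal c G s n T) (hGT : ∀ v w, G v w = c.ip (T v) (T w))
    (he : IsOrthonormal c G e₁ e₂) (hs : 0 < ((s : ℤ) : ℝ) * planeDet e₁ e₂) :
    n = c.gaussSign • c.cross (T e₁) (T e₂) := by
  have hG (v w : Plane) : G v w = G w v := by rw [hGT, hGT, c.ip_comm]
  rw [← he.quarterTurn_left hG hs, ← hT.ip_self_smul_eq_cross, ← hGT, he.1, one_smul]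

theorem comp (hT : IsConformal c G s n T) (hG : ∀ v w, G v w = G w v) (L : Plane →L[ℝ] Plane)
    {s' : ℤˣ} (h : 0 < ((s' : ℤ) : ℝ) * ((s : ℤ) * planeDet (L E₀) (L E₁))) :
    IsConformal c (G.compl₁₂ L.toLinearMap L.toLinearMap) s' n (T ∘L L) where
  normal v := hT.normal (L v)
  map_quarterTurn v := by
    rw [ContinuousLinearMap.comp_apply, Kenmotsu.map_quarterTurn L hG h, hT.map_quarterTurn,
      ContinuousLinearMap.comp_apply]

theorem const_smul (hT : IsConformal c G s n T) (r : ℝ) : IsConformal c G s n (r • T) where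
  normal v := by rw [smul_apply, c.ip_smul_left, hT.normal, mul_zero]
  map_quarterTurn v := by rw [smul_apply, smul_apply, hT.map_quarterTurn, map_smul]

theorem of_smul {m : ℝ} {s' : ℤˣ} (hT : IsConformal c G s n T)
    (h : 0 < ((s' : ℤ) : ℝ) * ((s : ℤ) * m)) : IsConformal c (m • G) s' n T where
  normal := hT.normal
  map_quarterTurn v := by rw [quarterTurn_smul h, hT.map_quarterTurn]

theorem exists_ip_eq (hT : IsConformal c G s n T) (hG : HasSignature c G)
    (hn : c.ip n n = c.normalSign) : ∃ m : ℝ, ∀ v w, c.ip (T v) (T w) = m * G v w := by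
  obtain ⟨e₁, e₂, he, hs⟩ := hG.exists_isOrthonormal s
  have hT2 : T e₂ = c.cross n (T e₁) := by
    rw [← hT.map_quarterTurn, he.quarterTurn_left hG.symm hs]
  have h22 : c.ip (T e₂) (T e₂) = c.frameSign * c.ip (T e₁) (T e₁) := by
    rw [hT2, SurfaceType.ip_cross_normal _ hn (hT.normal _)]
  have h12 : c.ip (T e₁) (T e₂) = 0 := by
    have := c.ip_cross_left n (T e₁) (T e₁)
    rw [← hT2, c.ip_comm] at this
    linarith
  refine ⟨c.ip (T e₁) (T e₁), fun v w => ?_⟩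
  conv_lhs => rw [he.eq_smul_add_smul hG.symm v, he.eq_smul_add_smul hG.symm w]
  conv_rhs => rw [he.eq_smul_add_smul hG.symm v, he.eq_smul_add_smul hG.symm w]
  simp only [map_add, map_smul, c.ip_add_left, c.ip_add_right, c.ip_smul_left, c.ip_smul_right,
    LinearMap.add_apply, LinearMap.smul_apply, smul_eq_mul, he.1, he.2.1, he.2.2, h22, h12,
    c.ip_comm (T e₂) (T e₁), hG.symm e₂ e₁]
  ring

theorem factor_pos (hT : IsConformal c G s n T) (hc : c.frameSign = 1)
    (hn : c.ip n n = c.normalSign) (h0 : T ≠ 0) {m : ℝ} (hG : HasSignature c G)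
    (hm : ∀ v w, c.ip (T v) (T w) = m * G v w) : 0 < m := by
  obtain ⟨v, hv⟩ : ∃ v, T v ≠ 0 := not_forall.1 fun h => h0 (ContinuousLinearMap.ext h)
  have hv0 : v ≠ 0 := fun h => hv (by rw [h, map_zero])
  have hpos := SurfaceType.ip_self_pos hc hn (hT.normal v) hv
  rw [hm] at hpos
  exact pos_of_mul_pos_left hpos ((hasSignature_iff_posDef hc hG.symm).1 hG v hv0).le

theorem factor_ne_zero (hT : IsConformal c G s n T)
    (hinj : Function.Injective T) {m : ℝ} (hG : HasSignature c G)
    (hm : ∀ v w, c.ip (T v) (T w) = m * G v w) : m ≠ 0 := by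
  rintro rfl
  obtain ⟨e₁, e₂, he, hs⟩ := hG.exists_isOrthonormal s
  refine c.cross_ne_zero_of_linearIndependent (a := T e₁) (b := T e₂) ?_ ?_
  · have h := (linearIndependent_of_planeDet_ne_zero (he.planeDet_ne_zero hG.symm)).map'
      T.toLinearMap (LinearMap.ker_eq_bot.2 hinj)
    rwa [show T.toLinearMap ∘ ![e₁, e₂] = ![T e₁, T e₂] by
      funext i; fin_cases i <;> rfl] at h
  · rw [← he.quarterTurn_left hG.symm hs, hT.map_quarterTurn, c.cross_cross, hT.normal, hm]
    simp

theorem ip_kenmotsuAt_left (hT : IsConformal c G s n T) (hG : ∀ v w, G v w = G w v)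
    (he : IsOrthonormal c G e₁ e₂) (hs : 0 < ((s : ℤ) : ℝ) * planeDet e₁ e₂) :
    c.ip (kenmotsuAt c G s n A e₁) (T e₁) =
      c.ip (A e₁) (T e₁) + c.frameSign * c.ip (A e₂) (T e₂) := by
  rw [kenmotsuAt_apply, c.ip_sub_left, c.ip_smul_left, c.ip_cross_left, ← hT.map_quarterTurn,
    he.quarterTurn_left hG hs]
  ring

theorem ip_kenmotsuAt_right (hT : IsConformal c G s n T) (hG : ∀ v w, G v w = G w v)
    (he : IsOrthonormal c G e₁ e₂) (hs : 0 < ((s : ℤ) : ℝ) * planeDet e₁ e₂) :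
    c.ip (kenmotsuAt c G s n A e₁) (T e₂) = c.ip (A e₁) (T e₂) - c.ip (A e₂) (T e₁) := by
  rw [kenmotsuAt_apply, c.ip_sub_left, c.ip_smul_left, c.ip_cross_left, ← hT.map_quarterTurn,
    he.quarterTurn_left hG hs, he.quarterTurn_right hG hs, map_smul, c.ip_smul_right]
  linear_combination -c.ip (A e₂) (T e₁) * c.frameSign_mul_self

theorem kenmotsuAt_eq_smul (hT : IsConformal c G s n T) (hn : c.ip n n = c.normalSign)
    (hA : ∀ v, c.ip (A v) n = 0) (hGT : ∀ v w, G v w = c.ip (T v) (T w)) (hG : HasSignature c G)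
    (hsymm : ∀ v w, c.ip (A v) (T w) = c.ip (A w) (T v))
    (he : IsOrthonormal c G e₁ e₂) (hs : 0 < ((s : ℤ) : ℝ) * planeDet e₁ e₂) {H : ℝ}
    (hH : -(2 * H) = c.ip (A e₁) (T e₁) + c.frameSign * c.ip (A e₂) (T e₂)) :
    kenmotsuAt c G s n A = -(2 * H) • T := by
  have hφ := isConformal_kenmotsuAt (s := s) hG hn hA
  have h1 : kenmotsuAt c G s n A e₁ = -(2 * H) • T e₁ := by
    refine sub_eq_zero.1 (SurfaceType.eq_zero_of_ip_eq_zero (hT.eq_cross hGT he hs) hn ?_ ?_ ?_)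
    · rw [c.ip_sub_left, c.ip_smul_left, hφ.normal, hT.normal, mul_zero, sub_zero]
    · rw [c.ip_sub_left, c.ip_smul_left, hT.ip_kenmotsuAt_left hG.symm he hs, ← hH, ← hGT, he.1]
      ring
    · rw [c.ip_sub_left, c.ip_smul_left, hT.ip_kenmotsuAt_right hG.symm he hs, hsymm, ← hGT,
        he.2.2]
      ring
  refine ext_of_planeDet_ne_zero (he.planeDet_ne_zero hG.symm) h1 ?_
  rw [← he.quarterTurn_left hG.symm hs, hφ.map_quarterTurn, h1, smul_apply, hT.map_quarterTurn,
    map_smul]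

theorem trace_eq (hT : IsConformal c G s n T) (hGT : ∀ v w, G v w = c.ip (T v) (T w))
    (he : IsOrthonormal c G e₁ e₂) {H : ℝ} (hφ : kenmotsuAt c G s n A = -(2 * H) • T) :
    -(2 * H) = c.ip (A e₁) (T e₁) + c.frameSign * c.ip (A e₂) (T e₂) := by
  have hG (v w : Plane) : G v w = G w v := by rw [hGT, hGT, c.ip_comm]
  have trace_eq_of_pos {e : Plane} (he : IsOrthonormal c G e₁ e)
      (hs : 0 < ((s : ℤ) : ℝ) * planeDet e₁ e) :
      -(2 * H) = c.ip (A e₁) (T e₁) + c.frameSign * c.ip (A e) (T e) := by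
    rw [← hT.ip_kenmotsuAt_left hG he hs, hφ, smul_apply, c.ip_smul_left, ← hGT, he.1, mul_one]
  have hs0 : ((s : ℤ) : ℝ) * planeDet e₁ e₂ ≠ 0 :=
    mul_ne_zero (by simp) (he.planeDet_ne_zero hG)
  rcases hs0.lt_or_gt with hs | hs
  · have hneg : planeDet e₁ (-e₂) = -planeDet e₁ e₂ := by simp only [planeDet, PiLp.neg_apply]; ring
    have h := trace_eq_of_pos he.neg_right (by rw [hneg, mul_neg]; exact neg_pos.2 hs)
    simpa [SurfaceType.ip] using h
  · exact trace_eq_of_pos he hs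

end IsConformal

end Conformal

/-! ### Smooth dependence on parameters -/

section Smooth

variable {E : Type*} [NormedAddCommGroup E] [NormedSpace ℝ E] {k : ℕ∞} {y : E}

theorem contDiffAt_clm_of_apply {F : Type*} [NormedAddCommGroup F] [NormedSpace ℝ F]
    {A : E → Plane →L[ℝ] F} (h : ∀ v, ContDiffAt ℝ k (fun z => A z v) y) :
    ContDiffAt ℝ k A y := by
  have hA : A = fun z =>
      ContinuousLinearMap.smulRightL ℝ Plane F (EuclideanSpace.proj 0) (A z E₀) +
        ContinuousLinearMap.smulRightL ℝ Plane F (EuclideanSpace.proj 1) (A z E₁) := by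
    ext z v
    conv_lhs => rw [eq_smul_add_smul v, map_add, map_smul, map_smul]
    rfl
  rw [hA]
  exact ((ContinuousLinearMap.contDiff _).contDiffAt.comp y (h E₀)).add
    ((ContinuousLinearMap.contDiff _).contDiffAt.comp y (h E₁))

variable {c : SurfaceType} {X Y : E → R3}

theorem contDiffAt_ip (hX : ContDiffAt ℝ k X y) (hY : ContDiffAt ℝ k Y y) :
    ContDiffAt ℝ k (fun z => c.ip (X z) (Y z)) y :=
  ((c.ipForm.toContinuousBilinearMap.contDiff.contDiffAt.comp y hX).clm_apply hY)

theorem contDiffAt_cross (hX : ContDiffAt ℝ k X y) (hY : ContDiffAt ℝ k Y y) :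
    ContDiffAt ℝ k (fun z => c.cross (X z) (Y z)) y := by
  have hx := contDiffAt_pi.1 hX
  have hy := contDiffAt_pi.1 hY
  refine contDiffAt_pi.2 fun i => ?_
  fin_cases i
  · exact ((hx 1).mul (hy 2)).sub ((hy 1).mul (hx 2))
  · exact ((hx 2).mul (hy 0)).sub ((hy 2).mul (hx 0))
  · exact contDiffAt_const.mul (((hx 0).mul (hy 1)).sub ((hy 0).mul (hx 1)))

theorem ip_fderiv_add_ip_fderiv {X' Y' : E →L[ℝ] R3} (hX : HasFDerivAt X X' y)
    (hY : HasFDerivAt Y Y' y) {a : ℝ} (h : ∀ᶠ z in 𝓝 y, c.ip (X z) (Y z) = a) (v : E) :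
    c.ip (X' v) (Y y) + c.ip (X y) (Y' v) = 0 := by
  have h0 := (c.ipForm.toContinuousBilinearMap.hasFDerivAt_of_bilinear hX hY).unique
    ((hasFDerivAt_const a y).congr_of_eventuallyEq h)
  rw [add_comm]
  exact congr($h0 v)

variable {G : E → PlaneForm} {s : ℤˣ}

theorem contDiffAt_quarterTurn (hG : ∀ u v, ContDiffAt ℝ k (fun z => G z u v) y)
    (h0 : gramDet (G y) E₀ E₁ ≠ 0) : ContDiffAt ℝ k (fun z => quarterTurn (G z) s) y := by
  refine contDiffAt_clm_of_apply fun v => ?_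
  have hD : ContDiffAt ℝ k (fun z => gramDet (G z) E₀ E₁) y :=
    ((hG E₀ E₀).mul (hG E₁ E₁)).sub ((hG E₀ E₁).mul (hG E₀ E₁))
  exact (contDiffAt_const.div ((hD.abs h0).sqrt (abs_ne_zero.2 h0))
    (Real.sqrt_ne_zero'.2 (abs_pos.2 h0))).smul
      (((hG v E₀).smul contDiffAt_const).sub ((hG v E₁).smul contDiffAt_const))

theorem contDiffAt_kenmotsuAt {A : E → Plane →L[ℝ] R3}
    (hG : ∀ u v, ContDiffAt ℝ k (fun z => G z u v) y) (h0 : gramDet (G y) E₀ E₁ ≠ 0)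
    (hX : ContDiffAt ℝ k X y) (hA : ContDiffAt ℝ k A y) :
    ContDiffAt ℝ k (fun z => kenmotsuAt c (G z) s (X z) (A z)) y := by
  refine contDiffAt_clm_of_apply fun v => ?_
  have hAJ := hA.clm_apply ((contDiffAt_quarterTurn (s := s) hG h0).clm_apply
    (contDiffAt_const (c := v)))
  exact (hA.clm_apply contDiffAt_const).sub (contDiffAt_const.smul (contDiffAt_cross hX hAJ))

end Smooth

/-! ### Forms and metrics in charts -/

section Charts

variable {M : Type*} [TopologicalSpace M] [ChartedSpace Plane M]

/-- The value of a 1-form at `p`, the tangent plane `T_pM` being the model plane by definition. -/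
def OneForm.valueAt (η : OneForm M) (p : M) : Plane →L[ℝ] R3 := η p

/-- The value of a field of bilinear forms at `p`, on the model plane as for `OneForm.valueAt`. -/
def BilinField.valueAt (g : BilinField M) (p : M) : PlaneForm := g p

/-- The coordinate frame `chartFrame p₀ y`, as an endomorphism of the model plane. -/
def frameMap (p₀ : M) (y : Plane) : Plane →L[ℝ] Plane := chartFrame p₀ y

/-- The expression of a 1-form in the preferred chart at `p₀`. -/
def localForm (η : OneForm M) (p₀ : M) (y : Plane) : Plane →L[ℝ] R3 :=
  η.valueAt ((extChartAt (𝓡 2) p₀).symm y) ∘L frameMap p₀ y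

/-- The expression of a field of bilinear forms in the preferred chart at `p₀`. -/
def metricInChart (g : BilinField M) (p₀ : M) (y : Plane) : PlaneForm :=
  (g.valueAt ((extChartAt (𝓡 2) p₀).symm y)).compl₁₂ (frameMap p₀ y).toLinearMap
    (frameMap p₀ y).toLinearMap

/-- Smoothness of a 1-form: its expression in the preferred chart at each point `p` is smooth at
the coordinates of `p`. -/
def IsSmoothForm (η : OneForm M) : Prop :=
  ∀ p, ContDiffAt ℝ ∞ (localForm η p) (extChartAt (𝓡 2) p p)

/-- Smoothness of a field of bilinear forms, expressed as in `IsSmoothForm`. -/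
def IsSmoothField (g : BilinField M) : Prop :=
  ∀ p u v, ContDiffAt ℝ ∞ (fun y => metricInChart g p y u v) (extChartAt (𝓡 2) p p)

theorem hasMFDerivAt_diff {f : M → R3} (hf : ContMDiff (𝓡 2) 𝓘(ℝ, R3) ∞ f) (p : M) :
    HasMFDerivAt (𝓡 2) 𝓘(ℝ, R3) f p (diff f p) :=
  (hf.mdifferentiableAt (by simp)).hasMFDerivAt

theorem isIntegralOf_of_contMDiff {x : M → R3} {η : OneForm M}
    (hx : ContMDiff (𝓡 2) 𝓘(ℝ, R3) ∞ x) (h : ∀ p, HasMFDerivAt (𝓡 2) 𝓘(ℝ, R3) x p (η p)) :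
    IsIntegralOf x η := by
  refine ⟨h, fun γ hγ a b => ?_⟩
  have hd (t : ℝ) :
      HasDerivAt (x ∘ γ) (η (γ t) (mfderiv 𝓘(ℝ, ℝ) (𝓡 2) γ t (1 : ℝ))) t :=
    HasFDerivAt.hasDerivAt (f' := (η (γ t) : Plane →L[ℝ] R3) ∘L
        (mfderiv 𝓘(ℝ, ℝ) (𝓡 2) γ t : ℝ →L[ℝ] Plane))
      ((h (γ t)).comp t (hγ.mdifferentiableAt one_ne_zero).hasMFDerivAt).hasFDerivAt
  have hcont : Continuous fun t => η (γ t) (mfderiv 𝓘(ℝ, ℝ) (𝓡 2) γ t (1 : ℝ)) := by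
    have hc : ContDiff ℝ 1 (x ∘ γ) := contMDiff_iff_contDiff.1 ((hx.of_le (by simp)).comp hγ)
    exact (hc.continuous_deriv le_rfl).congr fun t => (hd t).deriv
  exact ⟨hcont.intervalIntegrable a b, (intervalIntegral.integral_eq_sub_of_hasDerivAt
    (fun t _ => hd t) (hcont.intervalIntegrable a b)).symm⟩

theorem contMDiffAt_of_comp_chart_symm {E : Type*} [NormedAddCommGroup E] [NormedSpace ℝ E]
    {f : M → E} {p : M}
    (h : ContDiffAt ℝ ∞ (f ∘ (extChartAt (𝓡 2) p).symm) (extChartAt (𝓡 2) p p)) :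
    ContMDiffAt (𝓡 2) 𝓘(ℝ, E) ∞ f p := by
  refine (h.contMDiffAt.comp p contMDiffAt_extChartAt).congr_of_eventuallyEq ?_
  filter_upwards [extChartAt_source_mem_nhds (I := 𝓡 2) p] with q hq
  rw [Function.comp_apply, Function.comp_apply, (extChartAt (𝓡 2) p).left_inv hq]

variable [IsManifold (𝓡 2) ∞ M] {p : M} {y : Plane}

theorem hasMFDerivAt_chart_symm (hy : y ∈ (extChartAt (𝓡 2) p).target) :
    HasMFDerivAt 𝓘(ℝ, Plane) (𝓡 2) (extChartAt (𝓡 2) p).symm y (chartFrame p y) :=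
  (((contMDiffOn_extChartAt_symm (n := ∞) p).contMDiffAt
    ((isOpen_extChartAt_target p).mem_nhds hy)).mdifferentiableAt (by simp)).hasMFDerivAt

theorem hasFDerivAt_comp_chart_symm {f : M → R3} {η : OneForm M}
    (hy : y ∈ (extChartAt (𝓡 2) p).target)
    (hf : HasMFDerivAt (𝓡 2) 𝓘(ℝ, R3) f ((extChartAt (𝓡 2) p).symm y)
      (η ((extChartAt (𝓡 2) p).symm y))) :
    HasFDerivAt (f ∘ (extChartAt (𝓡 2) p).symm) (localForm η p y) y :=
  (hf.comp y (hasMFDerivAt_chart_symm hy)).hasFDerivAt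

theorem localForm_diff {f : M → R3} (hf : ContMDiff (𝓡 2) 𝓘(ℝ, R3) ∞ f)
    (hy : y ∈ (extChartAt (𝓡 2) p).target) :
    localForm (diff f) p y = fderiv ℝ (f ∘ (extChartAt (𝓡 2) p).symm) y :=
  (hasFDerivAt_comp_chart_symm hy (hasMFDerivAt_diff hf _)).fderiv.symm

theorem contDiffAt_comp_chart_symm {E : Type*} [NormedAddCommGroup E] [NormedSpace ℝ E]
    {f : M → E} (hf : ContMDiff (𝓡 2) 𝓘(ℝ, E) ∞ f) (p : M) :
    ContDiffAt ℝ ∞ (f ∘ (extChartAt (𝓡 2) p).symm) (extChartAt (𝓡 2) p p) :=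
  (contMDiffOn_iff_contDiffOn.1 (hf.comp_contMDiffOn (contMDiffOn_extChartAt_symm p))).contDiffAt
    (extChartAt_target_mem_nhds p)

theorem tangentCoordChange_comp_frameMap (hy : y ∈ (extChartAt (𝓡 2) p).target) :
    tangentCoordChange (𝓡 2) ((extChartAt (𝓡 2) p).symm y) p ((extChartAt (𝓡 2) p).symm y) ∘L
      frameMap p y = ContinuousLinearMap.id ℝ Plane := by
  have h := mfderiv_extChartAt_comp_mfderivWithin_extChartAt_symm (I := 𝓡 2) hy
  have hs : (extChartAt (𝓡 2) p).symm y ∈ (chartAt Plane p).source := by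
    simpa using (extChartAt (𝓡 2) p).map_target hy
  rw [(hasMFDerivAt_extChartAt hs).mfderiv, mfderiv_chartAt_eq_tangentCoordChange hs,
    ModelWithCorners.range_eq_univ, mfderivWithin_univ] at h
  exact h

theorem frameMap_comp_tangentCoordChange {q : M} (hq : q ∈ (extChartAt (𝓡 2) p).source) :
    frameMap p (extChartAt (𝓡 2) p q) ∘L tangentCoordChange (𝓡 2) q p q =
      ContinuousLinearMap.id ℝ Plane := by
  have h := mfderivWithin_extChartAt_symm_comp_mfderiv_extChartAt' (I := 𝓡 2) hq
  have hs : q ∈ (chartAt Plane p).source := by simpa using hq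
  rw [(hasMFDerivAt_extChartAt hs).mfderiv, mfderiv_chartAt_eq_tangentCoordChange hs,
    ModelWithCorners.range_eq_univ, mfderivWithin_univ] at h
  exact h

theorem frameMap_self (p : M) :
    frameMap p (extChartAt (𝓡 2) p p) = ContinuousLinearMap.id ℝ Plane := by
  have h := mfderivWithin_range_extChartAt_symm (I := 𝓡 2) (x := p)
  rw [ModelWithCorners.range_eq_univ, mfderivWithin_univ] at h
  exact h

theorem localForm_self (η : OneForm M) (p : M) :
    localForm η p (extChartAt (𝓡 2) p p) = η.valueAt p := by
  rw [localForm, frameMap_self, extChartAt_to_inv]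
  rfl

theorem metricInChart_self (g : BilinField M) (p : M) :
    metricInChart g p (extChartAt (𝓡 2) p p) = g.valueAt p := by
  rw [metricInChart, frameMap_self, extChartAt_to_inv]
  rfl

theorem hasFDerivAt_comp_chart_symm_self {f : M → R3} (hf : ContMDiff (𝓡 2) 𝓘(ℝ, R3) ∞ f)
    (p : M) : HasFDerivAt (f ∘ (extChartAt (𝓡 2) p).symm) ((diff f).valueAt p)
      (extChartAt (𝓡 2) p p) := by
  rw [← localForm_self]
  exact hasFDerivAt_comp_chart_symm (mem_extChartAt_target p) (hasMFDerivAt_diff hf _)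

theorem planeDet_eq_det (L : Plane →L[ℝ] Plane) :
    planeDet (L E₀) (L E₁) = LinearMap.det (L : Plane →ₗ[ℝ] Plane) := by
  rw [← LinearMap.det_toMatrix (EuclideanSpace.basisFun (Fin 2) ℝ).toBasis, Matrix.det_fin_two]
  simp [LinearMap.toMatrix_apply, planeDet, E₀, E₁]
  ring

theorem eventually_orientation (o : SurfaceOrientation M) (p : M) :
    ∀ᶠ y in 𝓝 (extChartAt (𝓡 2) p p),
      0 < ((o.sign p : ℤ) : ℝ) * ((o.sign ((extChartAt (𝓡 2) p).symm y) : ℤ) *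
        planeDet (frameMap p y E₀) (frameMap p y E₁)) := by
  have hpos := (continuousAt_extChartAt_symm (I := 𝓡 2) p).eventually
    (by rw [extChartAt_to_inv]; exact o.continuous' p)
  filter_upwards [hpos, extChartAt_target_mem_nhds (I := 𝓡 2) p] with y hy hyt
  set q := (extChartAt (𝓡 2) p).symm y
  set d := planeDet (frameMap p y E₀) (frameMap p y E₁) with hd
  have hinv : LinearMap.det (tangentCoordChange (𝓡 2) q p q : Plane →ₗ[ℝ] Plane) * d = 1 := by
    rw [hd, planeDet_eq_det, ← LinearMap.det_comp]
    exact congr(LinearMap.det ($(tangentCoordChange_comp_frameMap hyt) : Plane →ₗ[ℝ] Plane)).trans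
      LinearMap.det_id
  have hd0 : 0 < d * d := mul_self_pos.2 (right_ne_zero_of_mul_eq_one hinv)
  refine lt_of_lt_of_eq (mul_pos hy hd0) ?_
  linear_combination (o.sign p : ℝ) * (o.sign q : ℤ) * d * hinv

theorem hasMFDerivAt_comp_chart {F : Plane → R3} {η : OneForm M} {q : M}
    (hq : q ∈ (extChartAt (𝓡 2) p).source)
    (hF : HasFDerivAt F (localForm η p (extChartAt (𝓡 2) p q)) (extChartAt (𝓡 2) p q)) :
    HasMFDerivAt (𝓡 2) 𝓘(ℝ, R3) (F ∘ extChartAt (𝓡 2) p) q (η.valueAt q) := by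
  have hs : q ∈ (chartAt Plane p).source := by simpa using hq
  have h := hF.hasMFDerivAt.comp q (hasMFDerivAt_extChartAt (I := 𝓡 2) hs)
  rw [mfderiv_chartAt_eq_tangentCoordChange hs] at h
  have hη : localForm η p (extChartAt (𝓡 2) p q) ∘L tangentCoordChange (𝓡 2) q p q =
      η.valueAt q := by
    rw [localForm, ContinuousLinearMap.comp_assoc, frameMap_comp_tangentCoordChange hq,
      (extChartAt (𝓡 2) p).left_inv hq, ContinuousLinearMap.comp_id]
  rw [← hη]
  exact h

theorem isSmoothForm_diff {f : M → R3} (hf : ContMDiff (𝓡 2) 𝓘(ℝ, R3) ∞ f) :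
    IsSmoothForm (diff f) := fun p => by
  refine ((contDiffAt_comp_chart_symm hf p).fderiv_right (m := ∞)
    (by simp)).congr_of_eventuallyEq ?_
  filter_upwards [extChartAt_target_mem_nhds (I := 𝓡 2) p] with y hy using localForm_diff hf hy

theorem isSmoothField_inducedMetric (c : SurfaceType) {x : M → R3}
    (hx : ContMDiff (𝓡 2) 𝓘(ℝ, R3) ∞ x) : IsSmoothField (inducedMetric c x) := fun p _ _ =>
  contDiffAt_ip ((isSmoothForm_diff hx p).clm_apply contDiffAt_const)
    ((isSmoothForm_diff hx p).clm_apply contDiffAt_const)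

theorem IsSmoothForm.smul {η : OneForm M} (hη : IsSmoothForm η) {f : M → ℝ}
    (hf : ContMDiff (𝓡 2) 𝓘(ℝ, ℝ) ∞ f) : IsSmoothForm fun p => f p • η p := fun p =>
  (contDiffAt_comp_chart_symm hf p).smul (hη p)

theorem contMDiff_factor {g g' : BilinField M} (hg : IsSmoothField g) (hg' : IsSmoothField g')
    (hpos : ∀ p, ∃ v, 0 < g.valueAt p v v) {m : M → ℝ}
    (hm : ∀ p, g'.valueAt p = m p • g.valueAt p) :
    ContMDiff (𝓡 2) 𝓘(ℝ, ℝ) ∞ m := fun p => by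
  obtain ⟨v, hv⟩ := hpos p
  have hne : metricInChart g p (extChartAt (𝓡 2) p p) v v ≠ 0 := by
    rw [metricInChart_self]; exact hv.ne'
  refine contMDiffAt_of_comp_chart_symm
    (((hg' p v v).div (hg p v v) hne).congr_of_eventuallyEq ?_)
  filter_upwards [(hg p v v).continuousAt.eventually_ne hne] with y hy
  exact eq_div_of_mul_eq hy congr($(hm _) (frameMap p y v) (frameMap p y v)).symm

end Charts

/-! ### Immersed surfaces and their Gauss maps -/

section Surfaces

variable {M : Type*} [TopologicalSpace M] [ChartedSpace Plane M] {c : SurfaceType}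
  {g : BilinField M} {x n : M → R3}

theorem inducedMetric_apply (c : SurfaceType) (x : M → R3) (p : M) (v w : Plane) :
    (inducedMetric c x).valueAt p v w =
      c.ip ((diff x).valueAt p v) ((diff x).valueAt p w) := rfl

theorem inducedMetric_symm (c : SurfaceType) (x : M → R3) (p : M) (v w : Plane) :
    (inducedMetric c x).valueAt p v w = (inducedMetric c x).valueAt p w v := c.ip_comm _ _

theorem IsMetric.hasSignature (hg : IsMetric c g) (p : M) : HasSignature c (g.valueAt p) := by
  obtain ⟨hsymm, -, h⟩ := hg
  cases c
  · exact (hasSignature_iff_posDef rfl (hsymm p)).2 (h p)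
  · exact (hasSignature_iff_posDef rfl (hsymm p)).2 (h p)
  · exact (hasSignature_timelike_iff (hsymm p)).2 (h p)

theorem isSurface_iff : IsSurface c x ↔ ContMDiff (𝓡 2) 𝓘(ℝ, R3) ∞ x ∧
    ∀ p, HasSignature c ((inducedMetric c x).valueAt p) := by
  have hsymm := inducedMetric_symm c x
  constructor
  · rintro ⟨hx, hinj, h⟩
    refine ⟨hx, fun p => ?_⟩
    cases c
    · refine (hasSignature_iff_posDef rfl (hsymm p)).2 fun v hv => ?_
      have hv' : (diff x).valueAt p v ≠ 0 := (map_ne_zero_iff _ (hinj p)).2 hv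
      rw [inducedMetric_apply]
      exact SurfaceType.ip_euclidean_self_pos hv'
    · exact (hasSignature_iff_posDef rfl (hsymm p)).2 (h p)
    · exact (hasSignature_timelike_iff (hsymm p)).2 (h p)
  · rintro ⟨hx, hsig⟩
    refine ⟨hx, fun p => (injective_iff_map_eq_zero ((diff x).valueAt p)).2 fun v hv => ?_, ?_⟩
    · obtain ⟨e₁, e₂, he, -⟩ := (hsig p).exists_isOrthonormal 1
      have h0 (w : Plane) : (inducedMetric c x).valueAt p v w = 0 := by
        rw [inducedMetric_apply, hv]; simp [SurfaceType.ip]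
      rw [he.eq_smul_add_smul (hsymm p) v, h0, h0]
      simp
    · cases c
      · trivial
      · exact fun p => (hasSignature_iff_posDef rfl (hsymm p)).1 (hsig p)
      · exact fun p => (hasSignature_timelike_iff (hsymm p)).1 (hsig p)

theorem IsMetric.isSmoothField (hg : IsMetric c g) : IsSmoothField g :=
  fun p u v => (hg.2.1 p u v).contDiffAt (extChartAt_target_mem_nhds p)

variable [IsManifold (𝓡 2) ∞ M] {o : SurfaceOrientation M}

theorem hodgeStar_eq (α : OneForm M) {p : M} (hG : HasSignature c (g.valueAt p)) :
    (hodgeStar g o α).valueAt p =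
      -c.frameSign • α.valueAt p ∘L quarterTurn (g.valueAt p) (o.sign p) := by
  set G := g.valueAt p
  set β := α.valueAt p
  have hM : gram g p = !![G E₀ E₀, G E₀ E₁; G E₀ E₁, G E₁ E₁] := by
    ext i j
    fin_cases i <;> fin_cases j <;> first | rfl | exact hG.symm _ _
  have hdet : (gram g p).det = gramDet G E₀ E₁ := by
    rw [hM, Matrix.det_fin_two_of]; rfl
  have hraise (i : Fin 2) :
      raise g α p i = (gram g p)⁻¹ i 0 • β E₀ + (gram g p)⁻¹ i 1 • β E₁ := Fin.sum_univ_two _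
  have hinv : (gram g p)⁻¹ =
      (gramDet G E₀ E₁)⁻¹ • !![G E₁ E₁, -G E₀ E₁; -G E₀ E₁, G E₀ E₀] := by
    rw [Matrix.inv_def, hdet, Ring.inverse_eq_inv', hM, Matrix.adjugate_fin_two_of]
  have hcoeff : -c.frameSign * ((o.sign p : ℤ) / √|gramDet G E₀ E₁|) =
      -((o.sign p : ℤ) * √|gramDet G E₀ E₁| * (gramDet G E₀ E₁)⁻¹) := by
    have hD := abs_pos.2 hG.gramDet_ne_zero
    rw [neg_mul, neg_inj, ← div_eq_mul_inv, mul_div_assoc', div_eq_div_iff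
      (Real.sqrt_ne_zero'.2 hD) hG.gramDet_ne_zero, mul_assoc _ √_ √_,
      Real.mul_self_sqrt hD.le, hG.abs_gramDet]
    ring
  have hv (v w : Plane) : G v w = v 0 * G E₀ w + v 1 * G E₁ w := by
    conv_lhs => rw [eq_smul_add_smul v]
    simp
  ext1 v
  have h : (hodgeStar g o α).valueAt p v =
    volCoeff g o p • (v 1 • raise g α p 0 - v 0 • raise g α p 1) := rfl
  rw [h, volCoeff, hraise, hraise, hdet, hinv, smul_apply, ContinuousLinearMap.comp_apply,
    quarterTurn_apply, map_smul, smul_smul, hcoeff, map_sub, map_smul, map_smul, hv v E₀,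
    hv v E₁, hG.symm E₁ E₀]
  simp only [Matrix.smul_apply, Matrix.of_apply, Matrix.cons_val', Matrix.cons_val_zero,
    Matrix.cons_val_one, Matrix.cons_val_fin_one, smul_eq_mul]
  module

theorem kenmotsuForm_eq {p : M} (hG : HasSignature c (g.valueAt p)) :
    (kenmotsuForm c g o n).valueAt p =
      kenmotsuAt c (g.valueAt p) (o.sign p) (n p) ((diff n).valueAt p) := by
  ext1 v
  have h : (kenmotsuForm c g o n).valueAt p v = (diff n).valueAt p v +
    c.cross (n p) ((hodgeStar g o (diff n)).valueAt p v) := rfl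
  rw [h, hodgeStar_eq _ hG, kenmotsuAt_apply, smul_apply, map_smul, neg_smul, ← sub_eq_add_neg]
  rfl

theorem isSmoothForm_kenmotsuForm (o : SurfaceOrientation M) (hg : IsSmoothField g)
    (hsig : ∀ p, HasSignature c (g.valueAt p)) (hn : ContMDiff (𝓡 2) 𝓘(ℝ, R3) ∞ n) :
    IsSmoothForm (kenmotsuForm c g o n) := fun p => by
  refine (contDiffAt_kenmotsuAt (c := c) (s := o.sign p) (hg p)
    (by rw [metricInChart_self]; exact (hsig p).gramDet_ne_zero)
    (contDiffAt_comp_chart_symm hn p) (isSmoothForm_diff hn p)).congr_of_eventuallyEq ?_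
  filter_upwards [eventually_orientation o p] with y hy
  rw [localForm, kenmotsuForm_eq (hsig _), kenmotsuAt_comp (hsig _).symm _ hy]
  rfl

namespace IsGaussMap

theorem isConformal (hn : IsGaussMap c o x n) (hx : IsSurface c x) (p : M) :
    c.ip (n p) (n p) = c.normalSign ∧ IsConformal c ((inducedMetric c x).valueAt p) (o.sign p) (n p)
      ((diff x).valueAt p) := by
  obtain ⟨e₁, e₂, he, hs⟩ := ((isSurface_iff.1 hx).2 p).exists_isOrthonormal (o.sign p)
  exact isConformal_of_eq_cross he (inducedMetric_apply c x p) hs (hn p e₁ e₂ he hs)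

theorem contMDiff (hn : IsGaussMap c o x n) (hx : IsSurface c x) :
    ContMDiff (𝓡 2) 𝓘(ℝ, R3) ∞ n := fun p => by
  obtain ⟨hsm, hsig⟩ := isSurface_iff.1 hx
  obtain ⟨v, hv⟩ := (hsig p).exists_pos
  have hG := isSmoothField_inducedMetric c hsm p
  have hv0 : metricInChart (inducedMetric c x) p (extChartAt (𝓡 2) p p) v v ≠ 0 := by
    rw [metricInChart_self]; exact hv.ne'
  have hD : gramDet (metricInChart (inducedMetric c x) p (extChartAt (𝓡 2) p p)) E₀ E₁ ≠ 0 := by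
    rw [metricInChart_self]; exact (hsig p).gramDet_ne_zero
  have hT := isSmoothForm_diff hsm p
  have hJ := contDiffAt_quarterTurn (s := o.sign p) hG hD
  have hcross := contDiffAt_cross (c := c) (hT.clm_apply (contDiffAt_const (c := v)))
    (hT.clm_apply (hJ.clm_apply (contDiffAt_const (c := v))))
  refine contMDiffAt_of_comp_chart_symm ((((hG v v).inv hv0).smul
    ((contDiffAt_const (c := c.gaussSign)).smul hcross)).congr_of_eventuallyEq ?_)
  filter_upwards [(hG v v).continuousAt.eventually_ne hv0, eventually_orientation o p] with y hy ho
  have hconf := (hn.isConformal hx _).2.comp (inducedMetric_symm c x _) (frameMap p y) ho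
  exact (eq_inv_smul_iff₀ hy).2 (hconf.ip_self_smul_eq_cross v)

end IsGaussMap

theorem ip_diff_self {a : ℝ} (hn : ContMDiff (𝓡 2) 𝓘(ℝ, R3) ∞ n)
    (h : ∀ p, c.ip (n p) (n p) = a) (p : M) (v : Plane) :
    c.ip ((diff n).valueAt p v) (n p) = 0 := by
  have hN := hasFDerivAt_comp_chart_symm_self hn p
  have h0 := ip_fderiv_add_ip_fderiv hN hN (.of_forall fun z => h _) v
  rw [Function.comp_apply, extChartAt_to_inv, c.ip_comm (n p)] at h0
  linarith

theorem ip_diff_diff_comm (hx : ContMDiff (𝓡 2) 𝓘(ℝ, R3) ∞ x) (hn : ContMDiff (𝓡 2) 𝓘(ℝ, R3) ∞ n)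
    (h : ∀ p v, c.ip ((diff x).valueAt p v) (n p) = 0) (p : M) (v w : Plane) :
    c.ip ((diff n).valueAt p v) ((diff x).valueAt p w) =
      c.ip ((diff n).valueAt p w) ((diff x).valueAt p v) := by
  set y₀ := extChartAt (𝓡 2) p p
  set X := x ∘ (extChartAt (𝓡 2) p).symm
  have two_le : (2 : ℕ∞ω) ≤ ∞ := WithTop.coe_le_coe.2 le_top
  have hX : ContDiffAt ℝ ∞ X y₀ := contDiffAt_comp_chart_symm hx p
  have hX' : fderiv ℝ X y₀ = (diff x).valueAt p := (hasFDerivAt_comp_chart_symm_self hx p).fderiv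
  have hX'' : HasFDerivAt (fderiv ℝ X) (fderiv ℝ (fderiv ℝ X) y₀) y₀ :=
    ((hX.fderiv_right (m := ∞) (by simp)).differentiableAt (by simp)).hasFDerivAt
  have deriv_eq (u z : Plane) : c.ip (fderiv ℝ (fderiv ℝ X) y₀ z u) (n p) +
      c.ip ((diff x).valueAt p u) ((diff n).valueAt p z) = 0 := by
    have hXu : HasFDerivAt (fun y => fderiv ℝ X y u) ((fderiv ℝ (fderiv ℝ X) y₀).flip u) y₀ := by
      simpa using hX''.clm_apply (hasFDerivAt_const u y₀)
    have h0 := ip_fderiv_add_ip_fderiv (c := c) hXu (hasFDerivAt_comp_chart_symm_self hn p)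
      (a := 0) ?_ z
    · rwa [hX', Function.comp_apply, extChartAt_to_inv] at h0
    · filter_upwards [extChartAt_target_mem_nhds (I := 𝓡 2) p] with y hy
      rw [← localForm_diff hx hy]
      exact h _ _
  have hsymm := hX.isSymmSndFDerivAt (by simpa using two_le) v w
  have hvw := deriv_eq v w
  have hwv := deriv_eq w v
  rw [← hsymm] at hvw
  rw [c.ip_comm ((diff n).valueAt p v), c.ip_comm ((diff n).valueAt p w)]
  linarith

theorem kenmotsuForm_inducedMetric {H : M → ℝ} (hx : IsSurface c x) (hn : IsGaussMap c o x n)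
    (hH : IsMeanCurvature c x n H) (p : M) :
    (kenmotsuForm c (inducedMetric c x) o n).valueAt p = -(2 * H p) • (diff x).valueAt p := by
  obtain ⟨hsm, hsig⟩ := isSurface_iff.1 hx
  obtain ⟨hnn, hT⟩ := hn.isConformal hx p
  obtain ⟨e₁, e₂, he, hs⟩ := (hsig p).exists_isOrthonormal (o.sign p)
  have hns := hn.contMDiff hx
  rw [kenmotsuForm_eq (hsig p)]
  refine hT.kenmotsuAt_eq_smul hnn (ip_diff_self hns (fun q => (hn.isConformal hx q).1) p)
    (inducedMetric_apply c x p) (hsig p)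
    (ip_diff_diff_comm hsm hns (fun q => (hn.isConformal hx q).2.normal) p) he hs ?_
  have hH' : H p = (-c.ip ((diff x).valueAt p e₁) ((diff n).valueAt p e₁) +
    c.frameSign * -c.ip ((diff x).valueAt p e₂) ((diff n).valueAt p e₂)) / 2 := hH p e₁ e₂ he
  rw [hH', c.ip_comm ((diff n).valueAt p e₁), c.ip_comm ((diff n).valueAt p e₂)]
  ring

theorem isIntegralOf_kenmotsuForm_inducedMetric {H : M → ℝ} (hx : IsSurface c x)
    (hn : IsGaussMap c o x n) (hH : IsMeanCurvature c x n H) (hH0 : ∀ p, H p ≠ 0) :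
    IsIntegralOf x fun p => -(1 / (2 * H p)) • kenmotsuForm c (inducedMetric c x) o n p := by
  refine isIntegralOf_of_contMDiff hx.1 fun p => ?_
  have h : -(1 / (2 * H p)) • (kenmotsuForm c (inducedMetric c x) o n).valueAt p =
      (diff x).valueAt p := by
    rw [kenmotsuForm_inducedMetric hx hn hH, smul_smul, neg_mul_neg,
      one_div_mul_cancel (mul_ne_zero two_ne_zero (hH0 p)), one_smul]
  exact h ▸ hasMFDerivAt_diff hx.1 p

end Surfaces

/-! ### Primitives of closed forms -/

section GermBundle

variable {X V : Type*} [TopologicalSpace X] [AddCommGroup V] {U : X → Set X} {f : X → X → V}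

/-- The covering space of `X` whose fibre over `q` consists of the germs at `q` of the functions
`f p + v` with `q ∈ U p` and `v : V` constant, trivialised over `U p` by `v`. -/
def germBundle [TopologicalSpace V] [DiscreteTopology V] (hU : ∀ p, IsOpen (U p))
    (hmem : ∀ p, p ∈ U p)
    (hf : ∀ p p', ∀ q ∈ U p ∩ U p', ∀ᶠ z in 𝓝 q, f p z - f p' z = f p q - f p' q) :
    FiberBundleCore X X V where
  baseSet := U
  isOpen_baseSet := hU
  indexAt := id
  mem_baseSet_at := hmem
  coordChange p p' q v := v + (f p q - f p' q)
  coordChange_self p q _ v := by simp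
  continuousOn_coordChange := by
    rintro p p' ⟨q, v⟩ ⟨hq, -⟩
    refine (continuousAt_const.congr (f := fun _ => v + (f p q - f p' q)) ?_).continuousWithinAt
    filter_upwards [(continuous_fst.tendsto (q, v)).eventually (hf p p' q hq),
      (continuous_snd.tendsto (q, v)).eventually (p := (· = v)) (by simp [nhds_discrete])]
      with w hw hv
    rw [hw, hv]
  coordChange_comp p p' p'' q _ v := by abel

/-- A continuous section of the covering space of germs glues the local functions. -/
theorem exists_global_of_local [SimplyConnectedSpace X] [LocallyPathConnectedSpace X]
    (hU : ∀ p, IsOpen (U p)) (hmem : ∀ p, p ∈ U p)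
    (hf : ∀ p p', ∀ q ∈ U p ∩ U p', ∀ᶠ z in 𝓝 q, f p z - f p' z = f p q - f p' q) :
    ∃ x : X → V, ∀ p, ∀ q ∈ U p, ∀ᶠ z in 𝓝 q, x z - f p z = x q - f p q := by
  let _ : TopologicalSpace V := ⊥
  have : DiscreteTopology V := ⟨rfl⟩
  let Z := germBundle hU hmem hf
  obtain ⟨p₀⟩ : Nonempty X := inferInstance
  have hcov : IsCoveringMap Z.proj := FiberBundle.isCoveringMap (F := V) (E := Z.Fiber)
  obtain ⟨S, ⟨-, hS⟩, -⟩ := hcov.existsUnique_continuousMap_lifts (ContinuousMap.id X) p₀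
    (⟨p₀, (0 : V)⟩ : Z.TotalSpace) rfl
  have hproj (q : X) : (S q).1 = q := congrFun hS q
  let val : Z.TotalSpace → V := fun e => e.2
  refine ⟨fun q => f q q + val (S q), fun p q hq => ?_⟩
  have hcoord (z : X) : (Z.localTriv p (S z)).2 = f z z + val (S z) - f p z := by
    have : (Z.localTriv p (S z)).2 = val (S z) + (f (S z).1 (S z).1 - f p (S z).1) := by
      rw [Z.localTriv_apply]; rfl
    rw [this, hproj]
    abel
  have hcont : ContinuousAt (fun z => (Z.localTriv p (S z)).2) q := by
    refine continuous_snd.continuousAt.comp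
      (ContinuousAt.comp (f := S) ?_ S.continuous.continuousAt)
    refine (Z.localTriv p).continuousOn.continuousAt ((Z.localTriv p).open_source.mem_nhds ?_)
    rw [Z.mem_localTriv_source, hproj]
    exact hq
  filter_upwards [hcont.eventually (p := (· = (Z.localTriv p (S q)).2)) (by simp [nhds_discrete])]
    with z hz
  rwa [hcoord, hcoord] at hz

end GermBundle

section Primitive

variable {M : Type*} [TopologicalSpace M] [ChartedSpace Plane M] {η : OneForm M} {p : M}

theorem IsClosedForm.const_smul (hη : IsClosedForm η) (r : ℝ) :
    IsClosedForm fun p => r • η p := fun p y hy => by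
  have h : formInChart (fun p => r • η p) p = r • formInChart η p := rfl
  rw [h, extDeriv_smul, hη p y hy, smul_zero]

theorem IsClosedForm.fderiv_localForm_symm (hη : IsClosedForm η) {y : Plane}
    (hy : y ∈ (extChartAt (𝓡 2) p).target) (hd : DifferentiableAt ℝ (localForm η p) y)
    (v w : Plane) : fderiv ℝ (localForm η p) y v w = fderiv ℝ (localForm η p) y w v := by
  have hd' : DifferentiableAt ℝ (formInChart η p) y :=
    (ContinuousAlternatingMap.ofSubsingletonLIE (𝕜 := ℝ) (E := Plane) (F := R3)
      (0 : Fin 1)).differentiable.differentiableAt.comp y hd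
  have hext := extDeriv_apply hd' ![v, w]
  have heval (u : Plane) : fderiv ℝ (fun z => localForm η p z u) y =
      (fderiv ℝ (localForm η p) y).flip u := by
    simpa using (hd.hasFDerivAt.clm_apply (hasFDerivAt_const u y)).fderiv
  have hw : (fun z => formInChart η p z ((0 : Fin 2).removeNth ![v, w])) =
      fun z => localForm η p z w := rfl
  have hv : (fun z => formInChart η p z ((1 : Fin 2).removeNth ![v, w])) =
      fun z => localForm η p z v := rfl
  rw [hη p y hy, Fin.sum_univ_two, hw, hv, heval, heval] at hext
  simp only [ContinuousAlternatingMap.coe_zero, Pi.zero_apply, Fin.val_zero, Fin.val_one, pow_zero,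
    pow_one, one_smul, neg_smul, Matrix.cons_val_zero, Matrix.cons_val_one,
    ContinuousLinearMap.flip_apply, ← sub_eq_add_neg] at hext
  exact sub_eq_zero.1 hext.symm

variable [IsManifold (𝓡 2) ∞ M]

theorem eventually_sub_eq {f f' : M → R3} {q : M}
    (hf : ∀ᶠ z in 𝓝 q, HasMFDerivAt (𝓡 2) 𝓘(ℝ, R3) f z (η z))
    (hf' : ∀ᶠ z in 𝓝 q, HasMFDerivAt (𝓡 2) 𝓘(ℝ, R3) f' z (η z)) :
    ∀ᶠ z in 𝓝 q, f z - f' z = f q - f' q := by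
  have hchart := (continuousAt_extChartAt_symm (I := 𝓡 2) q).eventually
    (by rw [extChartAt_to_inv]; exact hf.and hf')
  obtain ⟨r, hr, hball⟩ := Metric.eventually_nhds_iff_ball.1
    (hchart.and (extChartAt_target_mem_nhds (I := 𝓡 2) q))
  let D := fun y => (f ∘ (extChartAt (𝓡 2) q).symm) y - (f' ∘ (extChartAt (𝓡 2) q).symm) y
  have hd : ∀ y ∈ Metric.ball (extChartAt (𝓡 2) q q) r, HasFDerivAt D (0 : Plane →L[ℝ] R3) y :=
    fun y hy => by
      obtain ⟨⟨hfy, hfy'⟩, ht⟩ := hball y hy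
      have h := (hasFDerivAt_comp_chart_symm ht hfy).sub (hasFDerivAt_comp_chart_symm ht hfy')
      rwa [sub_self] at h
  have hconst : ∀ y ∈ Metric.ball (extChartAt (𝓡 2) q q) r, D y = f q - f' q := fun y hy => by
    simpa [D] using Metric.isOpen_ball.is_const_of_fderiv_eq_zero (𝕜 := ℝ)
      (convex_ball _ _).isPreconnected
      (fun y hy => (hd y hy).differentiableAt.differentiableWithinAt)
      (fun y hy => (hd y hy).fderiv) hy (Metric.mem_ball_self hr)
  filter_upwards [(continuousAt_extChartAt (I := 𝓡 2) q).eventually (Metric.ball_mem_nhds _ hr),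
    extChartAt_source_mem_nhds (I := 𝓡 2) q] with z hz hzs
  simpa only [D, Function.comp_apply, (extChartAt (𝓡 2) q).left_inv hzs] using hconst _ hz

theorem IsSmoothForm.contMDiff_of_hasMFDerivAt (hη : IsSmoothForm η) {x : M → R3}
    (h : ∀ p, HasMFDerivAt (𝓡 2) 𝓘(ℝ, R3) x p (η p)) : ContMDiff (𝓡 2) 𝓘(ℝ, R3) ∞ x :=
  fun p => contMDiffAt_of_comp_chart_symm <| contDiffAt_infty.2 fun k =>
    (contDiffAt_succ_iff_hasFDerivAt.2 ⟨localForm η p,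
      ⟨_, extChartAt_target_mem_nhds p, fun _ hy => hasFDerivAt_comp_chart_symm hy (h _)⟩,
      contDiffAt_infty.1 (hη p) k⟩).of_le (by simp)

theorem IsSmoothForm.exists_local_primitive (hη : IsSmoothForm η) (hcl : IsClosedForm η) (p : M) :
    ∃ (U : Set M) (f : M → R3), IsOpen U ∧ p ∈ U ∧
      ∀ q ∈ U, HasMFDerivAt (𝓡 2) 𝓘(ℝ, R3) f q (η q) := by
  obtain ⟨r, hr, hball⟩ := Metric.eventually_nhds_iff_ball.1
    ((((hη p).of_le (m := 1) (by simp)).eventually (by simp)).and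
      (extChartAt_target_mem_nhds (I := 𝓡 2) p))
  have hd : ∀ y ∈ Metric.ball (extChartAt (𝓡 2) p p) r, DifferentiableAt ℝ (localForm η p) y :=
    fun y hy => (hball y hy).1.differentiableAt one_ne_zero
  obtain ⟨F, hF⟩ := Convex.exists_forall_hasFDerivAt_of_fderiv_symmetric
    (convex_ball (extChartAt (𝓡 2) p p) r) Metric.isOpen_ball
    (fun y hy => (hd y hy).differentiableWithinAt)
    fun y hy v w => hcl.fderiv_localForm_symm (hball y hy).2 (hd y hy) v w
  exact ⟨_, F ∘ extChartAt (𝓡 2) p, isOpen_extChartAt_preimage' p Metric.isOpen_ball,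
    ⟨mem_extChartAt_source p, Metric.mem_ball_self hr⟩,
    fun q hq => hasMFDerivAt_comp_chart hq.1 (hF _ hq.2)⟩

theorem IsSmoothForm.exists_primitive [SimplyConnectedSpace M] (hη : IsSmoothForm η)
    (hcl : IsClosedForm η) : ∃ x : M → R3, ∀ p, HasMFDerivAt (𝓡 2) 𝓘(ℝ, R3) x p (η p) := by
  have : LocallyPathConnectedSpace M := ChartedSpace.locallyPathConnectedSpace Plane M
  choose U f hU hmem hf using hη.exists_local_primitive hcl
  have hev (p q : M) (hq : q ∈ U p) : ∀ᶠ z in 𝓝 q, HasMFDerivAt (𝓡 2) 𝓘(ℝ, R3) (f p) z (η z) :=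
    Filter.mem_of_superset ((hU p).mem_nhds hq) (hf p)
  obtain ⟨x, hx⟩ := exists_global_of_local hU hmem fun p p' q hq =>
    eventually_sub_eq (hev p q hq.1) (hev p' q hq.2)
  refine ⟨x, fun p => ?_⟩
  have hadd : HasMFDerivAt (𝓡 2) 𝓘(ℝ, R3) (fun z => f p z + (x p - f p p)) p (η p) := by
    have h := (hf p p (hmem p)).add
      (hasMFDerivAt_const (I := 𝓡 2) (I' := 𝓘(ℝ, R3)) (x p - f p p) p)
    have h0 : (η p : Plane →L[ℝ] R3) + 0 = η p := add_zero _
    exact h0 ▸ h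
  refine hadd.congr_of_eventuallyEq ?_
  filter_upwards [hx p p (hmem p)] with z hz
  rw [← hz, add_sub_cancel]

end Primitive

/-! ### The converse of the representation formula -/

section Converse

variable {M : Type*} [TopologicalSpace M] [ChartedSpace Plane M] {c : SurfaceType}
  {g : BilinField M} {x n : M → R3} {m H : M → ℝ}

theorem IsNondegenerate.smul {η : OneForm M} {r : M → ℝ} (hη : IsNondegenerate c η)
    (hr : ∀ p, r p ≠ 0) : IsNondegenerate c fun p => r p • η p := by
  cases c
  · exact fun p => smul_ne_zero (hr p) (hη p)
  · exact fun p => smul_ne_zero (hr p) (hη p)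
  · exact fun p => (smul_right_injective R3 (hr p)).comp (hη p)

theorem isSurface_of_inducedMetric_eq_smul (hx : ContMDiff (𝓡 2) 𝓘(ℝ, R3) ∞ x)
    (hg : ∀ p, HasSignature c (g.valueAt p))
    (hm : ∀ p, (inducedMetric c x).valueAt p = m p • g.valueAt p) (h0 : ∀ p, m p ≠ 0)
    (hpos : c.frameSign = 1 → ∀ p, 0 < m p) : IsSurface c x :=
  isSurface_iff.2 ⟨hx, fun p => hm p ▸ (hg p).smul (h0 p) fun hc => hpos hc p⟩

variable [IsManifold (𝓡 2) ∞ M] {o : SurfaceOrientation M}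

theorem isConformal_diff_of_eq_smul {r : M → ℝ} (hg : ∀ p, HasSignature c (g.valueAt p))
    (hn : ContMDiff (𝓡 2) 𝓘(ℝ, R3) ∞ n) (hnn : ∀ p, c.ip (n p) (n p) = c.normalSign)
    (hx : ∀ p, (diff x).valueAt p = r p • (kenmotsuForm c g o n).valueAt p) (p : M) :
    IsConformal c (g.valueAt p) (o.sign p) (n p) ((diff x).valueAt p) := by
  rw [hx, kenmotsuForm_eq (hg p)]
  exact (isConformal_kenmotsuAt (hg p) (hnn p) (ip_diff_self hn hnn p)).const_smul (r p)

section Conformal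

variable (hg : ∀ p, HasSignature c (g.valueAt p))
  (hT : ∀ p, IsConformal c (g.valueAt p) (o.sign p) (n p) ((diff x).valueAt p))

include hg hT

theorem exists_inducedMetric_eq_smul (hnn : ∀ p, c.ip (n p) (n p) = c.normalSign) :
    ∃ m : M → ℝ, ∀ p, (inducedMetric c x).valueAt p = m p • g.valueAt p := by
  choose m hm using fun p => (hT p).exists_ip_eq (hg p) (hnn p)
  exact ⟨m, fun p => LinearMap.ext₂ (hm p)⟩

variable (hm : ∀ p, (inducedMetric c x).valueAt p = m p • g.valueAt p)

include hm

theorem inducedMetric_factor_pos (hc : c.frameSign = 1)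
    (hnn : ∀ p, c.ip (n p) (n p) = c.normalSign) (hnd : IsNondegenerate c (diff x)) (p : M) :
    0 < m p := by
  have h0 : (diff x).valueAt p ≠ 0 := by
    cases c
    · exact hnd p
    · exact hnd p
    · norm_num [SurfaceType.frameSign] at hc
  exact (hT p).factor_pos hc (hnn p) h0 (hg p) fun v w => congr($(hm p) v w)

theorem inducedMetric_factor_ne_zero (hnn : ∀ p, c.ip (n p) (n p) = c.normalSign)
    (hnd : IsNondegenerate c (diff x)) (p : M) : m p ≠ 0 := by
  cases c
  · exact (inducedMetric_factor_pos hg hT hm rfl hnn hnd p).ne'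
  · exact (inducedMetric_factor_pos hg hT hm rfl hnn hnd p).ne'
  · exact (hT p).factor_ne_zero (hnd p) (hg p) fun v w => congr($(hm p) v w)

omit hg

theorem isGaussMap_of_inducedMetric_eq_smul {o' : SurfaceOrientation M}
    (ho : ∀ p, 0 < ((o'.sign p : ℤ) : ℝ) * ((o.sign p : ℤ) * m p)) : IsGaussMap c o' x n :=
  fun p e₁ e₂ he hs => by
    have hT' := (hT p).of_smul (ho p)
    rw [← hm p] at hT'
    exact hT'.eq_cross (inducedMetric_apply c x p) he hs

include hg

theorem isMeanCurvature_of_kenmotsuForm_eq (h0 : ∀ p, m p ≠ 0)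
    (hφ : ∀ p, (kenmotsuForm c g o n).valueAt p = -(2 * H p) • (diff x).valueAt p) :
    IsMeanCurvature c x n H := fun p e₁ e₂ he => by
  obtain ⟨s, hs⟩ : ∃ s : ℤˣ, 0 < ((s : ℤ) : ℝ) * ((o.sign p : ℤ) * m p) := by
    rcases (mul_ne_zero (by simp : ((o.sign p : ℤ) : ℝ) ≠ 0) (h0 p)).lt_or_gt with h | h
    · exact ⟨-1, by simpa using h⟩
    · exact ⟨1, by simpa using h⟩
  have hT' := (hT p).of_smul hs
  have hφ' := hφ p
  rw [kenmotsuForm_eq (hg p), kenmotsuAt, ← quarterTurn_smul hs, ← kenmotsuAt] at hφ'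
  rw [← hm p] at hT' hφ'
  have htrace := hT'.trace_eq (inducedMetric_apply c x p) he hφ'
  change H p = (-c.ip ((diff x).valueAt p e₁) ((diff n).valueAt p e₁) +
    c.frameSign * -c.ip ((diff x).valueAt p e₂) ((diff n).valueAt p e₂)) / 2
  rw [c.ip_comm ((diff n).valueAt p e₁), c.ip_comm ((diff n).valueAt p e₂)] at htrace
  linarith

theorem isGaussMap_or_isGaussMap_neg [PreconnectedSpace M] (hgs : IsSmoothField g)
    (hx : ContMDiff (𝓡 2) 𝓘(ℝ, R3) ∞ x) (h0 : ∀ p, m p ≠ 0)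
    (hpos : c.frameSign = 1 → ∀ p, 0 < m p) :
    IsGaussMap c o x n ∨ (c = .timelike ∧ IsGaussMap c (-o) x n) := by
  have hcont : Continuous m := (contMDiff_factor hgs (isSmoothField_inducedMetric c hx)
    (fun p => (hg p).exists_pos) hm).continuous
  by_cases hp : ∀ p, 0 < m p
  · refine .inl (isGaussMap_of_inducedMetric_eq_smul hT hm fun p => ?_)
    rw [← mul_assoc, cast_sign_mul_self, one_mul]
    exact hp p
  · have hneg (p : M) : m p < 0 := by
      refine (h0 p).lt_of_le (not_lt.1 fun hp' => ?_)
      obtain ⟨q, hq⟩ := not_forall.1 hp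
      obtain ⟨r, hr⟩ := mem_range_of_exists_le_of_exists_ge hcont ⟨q, not_lt.1 hq⟩ ⟨p, hp'.le⟩
      exact h0 r hr
    refine .inr ⟨?_, isGaussMap_of_inducedMetric_eq_smul hT hm fun p => ?_⟩
    · cases c
      · exact absurd (hpos rfl) hp
      · exact absurd (hpos rfl) hp
      · rfl
    · have hs : (((-o).sign p : ℤ) : ℝ) = -(o.sign p : ℤ) := by
        rw [show (-o).sign p = -o.sign p from rfl, Units.val_neg, Int.cast_neg]
      rw [hs, ← mul_assoc, neg_mul, cast_sign_mul_self, neg_one_mul]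
      exact neg_pos.2 (hneg p)

end Conformal

theorem isSmoothForm_smul_kenmotsuForm (o : SurfaceOrientation M) (hg : IsMetric c g)
    (hn : ContMDiff (𝓡 2) 𝓘(ℝ, R3) ∞ n) (hH : ContMDiff (𝓡 2) 𝓘(ℝ, ℝ) ∞ H) (hH0 : ∀ p, H p ≠ 0) :
    IsSmoothForm fun p => -(1 / (2 * H p)) • kenmotsuForm c g o n p :=
  (isSmoothForm_kenmotsuForm o hg.isSmoothField hg.hasSignature hn).smul
    (contMDiff_const.div₀ (contMDiff_const.mul hH) fun p => mul_ne_zero two_ne_zero (hH0 p)).neg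

theorem exists_isIntegralOf_kenmotsuForm [SimplyConnectedSpace M] (hg : IsMetric c g)
    (hn : ContMDiff (𝓡 2) 𝓘(ℝ, R3) ∞ n) (hH : ContMDiff (𝓡 2) 𝓘(ℝ, ℝ) ∞ H)
    (hH0 : ∀ p, H p ≠ 0) (hcl : IsClosedForm fun p => (1 / H p) • kenmotsuForm c g o n p) :
    ∃ x : M → R3, IsIntegralOf x fun p => -(1 / (2 * H p)) • kenmotsuForm c g o n p := by
  have hη := isSmoothForm_smul_kenmotsuForm o hg hn hH hH0
  have hcl' : IsClosedForm fun p => -(1 / (2 * H p)) • kenmotsuForm c g o n p := by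
    convert hcl.const_smul (-(1 / 2)) using 2 with p
    rw [smul_smul, neg_mul, one_div_mul_one_div]
  obtain ⟨x, hx⟩ := hη.exists_primitive hcl'
  exact ⟨x, isIntegralOf_of_contMDiff (hη.contMDiff_of_hasMFDerivAt hx) hx⟩

theorem isSurface_and_isMeanCurvature_and_isGaussMap [PreconnectedSpace M] (hg : IsMetric c g)
    (hn : ContMDiff (𝓡 2) 𝓘(ℝ, R3) ∞ n) (hnn : ∀ p, c.ip (n p) (n p) = c.normalSign)
    (hH : ContMDiff (𝓡 2) 𝓘(ℝ, ℝ) ∞ H) (hH0 : ∀ p, H p ≠ 0)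
    (hnd : IsNondegenerate c (kenmotsuForm c g o n))
    (hx : ∀ p, HasMFDerivAt (𝓡 2) 𝓘(ℝ, R3) x p (-(1 / (2 * H p)) • kenmotsuForm c g o n p)) :
    IsSurface c x ∧ IsMeanCurvature c x n H ∧
      (IsGaussMap c o x n ∨ (c = .timelike ∧ IsGaussMap c (-o) x n)) := by
  have hsig := hg.hasSignature
  have hxs := (isSmoothForm_smul_kenmotsuForm o hg hn hH hH0).contMDiff_of_hasMFDerivAt hx
  have hdiff : diff x = fun p => -(1 / (2 * H p)) • kenmotsuForm c g o n p :=
    funext fun p => (hx p).mfderiv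
  have hr (p : M) : -(1 / (2 * H p)) ≠ 0 :=
    neg_ne_zero.2 (one_div_ne_zero (mul_ne_zero two_ne_zero (hH0 p)))
  have hdiff' (p : M) : (diff x).valueAt p = -(1 / (2 * H p)) • (kenmotsuForm c g o n).valueAt p :=
    congrFun hdiff p
  have hφ (p : M) : (kenmotsuForm c g o n).valueAt p = -(2 * H p) • (diff x).valueAt p := by
    rw [hdiff', smul_smul, neg_mul_neg, mul_one_div_cancel (mul_ne_zero two_ne_zero (hH0 p)),
      one_smul]
  have hnd' : IsNondegenerate c (diff x) := hdiff ▸ hnd.smul hr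
  have hT := isConformal_diff_of_eq_smul hsig hn hnn hdiff'
  obtain ⟨m, hm⟩ := exists_inducedMetric_eq_smul hsig hT hnn
  have h0 := inducedMetric_factor_ne_zero hsig hT hm hnn hnd'
  have hpos := fun hc => inducedMetric_factor_pos hsig hT hm hc hnn hnd'
  exact ⟨isSurface_of_inducedMetric_eq_smul hxs hsig hm h0 hpos,
    isMeanCurvature_of_kenmotsuForm_eq hsig hT hm h0 hφ,
    isGaussMap_or_isGaussMap_neg hsig hT hm hg.isSmoothField hxs h0 hpos⟩

end Converse

end Kenmotsu

end

open Kenmotsu in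
theorem theorem2p1_general {M : Type*} [TopologicalSpace M]
    [ChartedSpace (EuclideanSpace ℝ (Fin 2)) M] [IsManifold (𝓡 2) ∞ M]
    (c : SurfaceType) (o : SurfaceOrientation M) :
    (∀ (x n : M → Fin 3 → ℝ) (H : M → ℝ),
        IsSurface c x → IsGaussMap c o x n → IsMeanCurvature c x n H → (∀ p, H p ≠ 0) →
        IsIntegralOf x fun p => -(1 / (2 * H p)) • kenmotsuForm c (inducedMetric c x) o n p) ∧
    (SimplyConnectedSpace M →
      ∀ (g : BilinField M) (n : M → Fin 3 → ℝ) (H : M → ℝ),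
        IsMetric c g → ContMDiff (𝓡 2) 𝓘(ℝ, Fin 3 → ℝ) ∞ n →
        ContMDiff (𝓡 2) 𝓘(ℝ, ℝ) ∞ H → (∀ p, H p ≠ 0) →
        IsClosedForm (fun p => (1 / H p) • kenmotsuForm c g o n p) →
        ∃ x : M → Fin 3 → ℝ,
          IsIntegralOf x fun p => -(1 / (2 * H p)) • kenmotsuForm c g o n p) ∧
    (PreconnectedSpace M →
      ∀ (g : BilinField M) (n : M → Fin 3 → ℝ) (H : M → ℝ),
        IsMetric c g → ContMDiff (𝓡 2) 𝓘(ℝ, Fin 3 → ℝ) ∞ n →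
        (∀ p, c.ip (n p) (n p) = c.normalSign) →
        ContMDiff (𝓡 2) 𝓘(ℝ, ℝ) ∞ H → (∀ p, H p ≠ 0) →
        IsNondegenerate c (kenmotsuForm c g o n) → ∀ x : M → Fin 3 → ℝ,
        (IsIntegralOf x fun p => -(1 / (2 * H p)) • kenmotsuForm c g o n p) →
        IsSurface c x ∧ IsMeanCurvature c x n H ∧
          (IsGaussMap c o x n ∨ (c = .timelike ∧ IsGaussMap c (-o) x n))) :=
  ⟨fun _ _ _ hx hn hH hH0 => isIntegralOf_kenmotsuForm_inducedMetric hx hn hH hH0,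
    fun _ _ _ _ hg hn hH hH0 hcl => exists_isIntegralOf_kenmotsuForm hg hn hH hH0 hcl,
    fun _ _ _ _ hg hn hnn hH hH0 hnd _ hx =>
      isSurface_and_isMeanCurvature_and_isGaussMap hg hn hnn hH hH0 hnd hx.1⟩

open Kenmotsu in
theorem theorem2p1 {M : Type*} [TopologicalSpace M] [T2Space M] [SecondCountableTopology M]
    [ChartedSpace (EuclideanSpace ℝ (Fin 2)) M] [IsManifold (𝓡 2) ∞ M]
    (c : SurfaceType) (o : SurfaceOrientation M) :
    (ConnectedSpace M →
      ∀ (x n : M → Fin 3 → ℝ) (H : M → ℝ),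
        IsSurface c x → IsGaussMap c o x n → IsMeanCurvature c x n H → (∀ p, H p ≠ 0) →
        IsIntegralOf x fun p => -(1 / (2 * H p)) • kenmotsuForm c (inducedMetric c x) o n p) ∧
    (SimplyConnectedSpace M →
      ∀ (g : BilinField M) (n : M → Fin 3 → ℝ) (H : M → ℝ),
        IsMetric c g →
        ContMDiff (𝓡 2) 𝓘(ℝ, Fin 3 → ℝ) ∞ n → (∀ p, c.ip (n p) (n p) = c.normalSign) →
        ContMDiff (𝓡 2) 𝓘(ℝ, ℝ) ∞ H → (∀ p, H p ≠ 0) →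
        IsClosedForm (fun p => (1 / H p) • kenmotsuForm c g o n p) →
        (∃ x : M → Fin 3 → ℝ,
          IsIntegralOf x fun p => -(1 / (2 * H p)) • kenmotsuForm c g o n p) ∧
        (IsNondegenerate c (kenmotsuForm c g o n) → ∀ x : M → Fin 3 → ℝ,
          (IsIntegralOf x fun p => -(1 / (2 * H p)) • kenmotsuForm c g o n p) →
          IsSurface c x ∧ IsMeanCurvature c x n H ∧
            (IsGaussMap c o x n ∨ (c = .timelike ∧ IsGaussMap c (-o) x n)))) := by
  obtain ⟨direct, exist, converse⟩ := theorem2p1_general c o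
  exact ⟨fun _ => direct, fun _ g n H hg hn hnn hH hH0 hcl =>
    ⟨exist ‹_› g n H hg hn hH hH0 hcl, converse inferInstance g n H hg hn hnn hH hH0⟩⟩
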